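/- **Theorem 2.1.** Let $v>0$. For every $n\ge 1$ let $\mathcal A_n=\{a(i,j)=a_n(i,j):1\le i\le j\le n\}$ be a family of independent real random variables with $$\mathbf E\,a(i,j)=0,\qquad \mathbf E\,a(i,j)^2=(1+\delta_{ij})v^2 ,$$ and for every $n$ and every real $0<p\le n$ let $\mathcal D_{n,p}=\{d_{n,p}(i,j):1\le i\le j\le n\}$ be a family of independent random variables, independent of $\mathcal A_n$, with $\mathbf P(d_{n,p}(i,j)=1)=p/n$ and $\mathbf P(d_{n,p}(i,j)=0)=1-p/n$; all are defined on one probability space $(\Omega,\mathcal F,\mathbf P)$. Let $H_{n,p}$ be the real symmetric $n\times n$ matrix with $$H_{n,p}(i,j)=\frac1{\sqrt p}\,a(i,j)\,d_{n,p}(i,j),\qquad 1\le i\le j\le n,$$ with eigenvalues $\lambda_1\le\dots\le\lambda_n$, and put $$g_{n,p}(z)=\frac1n\operatorname{Tr}(H_{n,p}-z)^{-1},\qquad \sigma(\lambda;H_{n,p})=\frac1n\,\#\{j:\lambda_j\le\lambda\}.$$ Assume that for some $\rho>0$ $$\mu_{2+\rho}=\sup_{n}\ \sup_{1\le i\le j\le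 n}\mathbf E|a(i,j)|^{2+\rho}<\infty .$$ Let $\sigma_{sc}$ be the semicircle distribution, with density $\frac1{2\pi v^2}\sqrt{4v^2-\lambda^2}$ for $|\lambda|\le 2v$ and $0$ otherwise. In the limit below, $n\to\infty$ and $p\to\infty$ jointly, subject only to $0<p\le n$. Then: 1. For every $z$ with $\operatorname{Im}z\ne0$ the equation $$w(z)=\frac1{-z-v^2w(z)}$$ has exactly one solution $w(z)\in\mathbb C$ with $\operatorname{Im}w(z)\cdot\operatorname{Im}z>0$. 2. For every $z$ with $|\operatorname{Im}z|\ge 2v+1$, $g_{n,p}(z)\to w(z)$ in probability as $n,p\to\infty$. 3. $w$ is the Stieltjes transform of the semicircle distribution, $w(z)=\int\frac{d\sigma_{sc}(\lambda)}{\lambda-z}$ for $\operatorname{Im}z\neq0$, and $\sigma_{sc}$ is the only probability measure on $\mathbb R$ with this Stieltjes transform. 4. Consequently $\sigma(\cdot\,;H_{n,p})\to\sigma_{sc}$ weakly in probability as $n,p\to\infty$: for every bounded continuous $f:\mathbb R\to\mathbb R$, $\int f\,d\sigma(\cdot\,;H_{n,p})\to\int f\,d\sigma_{sc}$ in probability,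 and for every $\lambda\in\mathbb R$, $\sigma(\lambda;H_{n,p})\to\sigma_{sc}((-\infty,\lambda])$ in probability. -/

import Mathlib

open MeasureTheory ProbabilityTheory Filter Topology
open scoped ENNReal BoundedContinuousFunction

noncomputable section

namespace DiluteWigner

/-- The pairs `(i, j)` with `i ≤ j`. -/
abbrev UpperPair (n : ℕ) : Type := {e : Fin n × Fin n // e.1 ≤ e.2}

/-- The standing assumptions on the families `a n = {a(i,j), i ≤ j}` (one for each size `n`):
independent, centred, with variance `(1 + δ_ij) v²`. Only the entries with `i ≤ j` matter. -/
structure IsWignerFamily {Ω : Type*} [MeasurableSpace Ω] (P : Measure Ω) (v : ℝ)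
    (a : (n : ℕ) → Fin n → Fin n → Ω → ℝ) : Prop where
  measurable : ∀ n, ∀ i j : Fin n, i ≤ j → Measurable (a n i j)
  indep : ∀ n, iIndepFun (fun (e : UpperPair n) => a n e.1.1 e.1.2) P
  mean : ∀ n, ∀ i j : Fin n, i ≤ j → ∫ ω, a n i j ω ∂P = 0
  variance : ∀ n, ∀ i j : Fin n, i ≤ j →
    ∫ ω, a n i j ω ^ 2 ∂P = (1 + if i = j then 1 else 0) * v ^ 2

/-- The families `d n p = {d(i,j), i ≤ j}`, for real `0 < p ≤ n`: independent Bernoulli variables,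
equal to `1` with probability `p / n` and to `0` with probability `1 - p / n`. -/
structure IsDilutionFamily {Ω : Type*} [MeasurableSpace Ω] (P : Measure Ω)
    (d : (n : ℕ) → ℝ → Fin n → Fin n → Ω → ℝ) : Prop where
  measurable : ∀ (n : ℕ) (p : ℝ), 0 < p → p ≤ n → ∀ i j : Fin n, i ≤ j → Measurable (d n p i j)
  indep : ∀ (n : ℕ) (p : ℝ), 0 < p → p ≤ n →
    iIndepFun (fun (e : UpperPair n) => d n p e.1.1 e.1.2) P
  prob_one : ∀ (n : ℕ) (p : ℝ), 0 < p → p ≤ n → ∀ i j : Fin n, i ≤ j →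
    P {ω | d n p i j ω = 1} = ENNReal.ofReal (p / n)
  prob_zero : ∀ (n : ℕ) (p : ℝ), 0 < p → p ≤ n → ∀ i j : Fin n, i ≤ j →
    P {ω | d n p i j ω = 0} = ENNReal.ofReal (1 - p / n)

/-- For all `0 < p ≤ n`, the whole family `d n p` is independent of the whole family `a n`. -/
def FamiliesIndep {Ω : Type*} [MeasurableSpace Ω] (P : Measure Ω)
    (a : (n : ℕ) → Fin n → Fin n → Ω → ℝ) (d : (n : ℕ) → ℝ → Fin n → Fin n → Ω → ℝ) : Prop :=
  ∀ (n : ℕ) (p : ℝ), 0 < p → p ≤ n →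
    IndepFun (fun ω (e : UpperPair n) => a n e.1.1 e.1.2 ω)
      (fun ω (e : UpperPair n) => d n p e.1.1 e.1.2 ω) P

/-- `μ_r`, the supremum of the absolute moments `E |a(i,j)|^r` over all entries and all sizes. -/
def absMoment {Ω : Type*} [MeasurableSpace Ω] (P : Measure Ω)
    (a : (n : ℕ) → Fin n → Fin n → Ω → ℝ) (r : ℝ) : ℝ≥0∞ :=
  ⨆ (n : ℕ) (i : Fin n) (j : Fin n) (_ : i ≤ j), ∫⁻ ω, ENNReal.ofReal (|a n i j ω| ^ r) ∂P

/-- The real symmetric matrix with entries `a(i,j) d(i,j) / √p` for `i ≤ j`. -/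
def diluteMatrix {n : ℕ} (p : ℝ) (a d : Fin n → Fin n → ℝ) : Matrix (Fin n) (Fin n) ℝ :=
  Matrix.of fun i j => (1 / √p) * a (min i j) (max i j) * d (min i j) (max i j)

theorem diluteMatrix_isHermitian {n : ℕ} (p : ℝ) (a d : Fin n → Fin n → ℝ) :
    (diluteMatrix p a d).IsHermitian := by
  ext i j
  simp [diluteMatrix, min_comm, max_comm]

/-- The resolvent `(A - z)⁻¹` of a real matrix. -/
def resolvent {n : ℕ} (A : Matrix (Fin n) (Fin n) ℝ) (z : ℂ) : Matrix (Fin n) (Fin n) ℂ :=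
  (A.map (fun x : ℝ => (x : ℂ)) - z • (1 : Matrix (Fin n) (Fin n) ℂ))⁻¹

/-- The normalized trace `n⁻¹ Tr (A - z)⁻¹`. -/
def resolventTrace {n : ℕ} (A : Matrix (Fin n) (Fin n) ℝ) (z : ℂ) : ℂ :=
  (n : ℂ)⁻¹ * (resolvent A z).trace

/-- The normalized eigenvalue counting function `n⁻¹ #{j : λ_j ≤ t}`. -/
def eigenvalueCount {n : ℕ} {A : Matrix (Fin n) (Fin n) ℝ} (hA : A.IsHermitian) (t : ℝ) : ℝ :=
  (n : ℝ)⁻¹ * (Finset.univ.filter fun j => hA.eigenvalues j ≤ t).card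

/-- The measure `n⁻¹ ∑ δ_{λ_j}`, whose distribution function is `eigenvalueCount`. -/
def spectralMeasure {n : ℕ} {A : Matrix (Fin n) (Fin n) ℝ} (hA : A.IsHermitian) : Measure ℝ :=
  (n : ℝ≥0∞)⁻¹ • ∑ j, Measure.dirac (hA.eigenvalues j)

/-- The semicircle density with variance parameter `v²`. -/
def semicircleDensity (v x : ℝ) : ℝ :=
  1 / (2 * Real.pi * v ^ 2) * if |x| ≤ 2 * v then √(4 * v ^ 2 - x ^ 2) else 0

/-- The semicircle law. -/
def semicircleMeasure (v : ℝ) : Measure ℝ :=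
  volume.withDensity fun x => ENNReal.ofReal (semicircleDensity v x)

/-- The distribution function of the semicircle law. -/
def semicircleCDF (v t : ℝ) : ℝ := ∫ x in Set.Iic t, semicircleDensity v x

/-- The Stieltjes transform of a measure on the line. -/
def stieltjes (ν : Measure ℝ) (z : ℂ) : ℂ := MeasureTheory.resolventTransform ν z

theorem stieltjes_eq (ν : Measure ℝ) (z : ℂ) :
    stieltjes ν z = ∫ x : ℝ, 1 / ((x : ℂ) - z) ∂ν := by
  simp [stieltjes, resolventTransform, _root_.resolvent]

/-- The joint limit `n, p → ∞` subject to `0 < p ≤ n`. -/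
def jointLimit : Filter (ℕ × ℝ) :=
  (atTop ×ˢ atTop) ⊓ 𝓟 {q : ℕ × ℝ | 0 < q.2 ∧ q.2 ≤ q.1}

end DiluteWigner

end

namespace DiluteWigner

/-! Write `G` for the resolvent, `g` for its normalized trace, and `Δ = 1 + z g + v² g²` for the
defect of `g` in the quadratic equation solved by the Stieltjes transform `w` of the semicircle law.
The core of the proof is that `𝔼 |Δ|² → 0`.

The identity `H G = 1 + z G` writes `Δ` as `n⁻¹` times the sum over `i, j` of `H_ij G_ji + (v²/n)
G_ii G_jj` (`quadraticDefect_eq_sum`). After multiplication by `conj Δ`, each off-diagonal term is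
expanded around the matrix whose entries `(i, j)` and `(j, i)` are set to zero, which is independent
of `h = H_ij`. The term linear in `h` has mean zero, and in the quadratic term `h²` may be replaced
by its mean `v²/n`, which cancels `(v²/n) G_ii G_jj`. What remains is `(v²/n) G_ji²`, whose sum is
small because the rows of `G` are square summable with a bound free of `n`
(`sum_norm_sq_resolvent_le`), a change of `Δ` of order `|h|/n`, lower-order terms, and a remainder
controlled by `|h| min(|h|, h²) ≤ |h|^(2+r)` with `r = min(ρ, 1)`. Dilution makes the mean of this
last quantity of order `n⁻¹ p^(-r/2)`; the `n²` terms with prefactor `n⁻¹` therefore contribute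
`p^(-r/2)`. The result is `integral_norm_sq_quadraticDefect_le`.

Since `Im g` and `Im w` have the sign of `Im z`, the factorization `Δ = (g - w)(z + v² (g + w))`
gives `|g - w| |Im z| ≤ |Δ|` (`norm_sub_mul_abs_im_le`). Hence `g → w` in probability at every
nonreal `z`, and the same inequality gives uniqueness of `w`.

Convergence in probability to a constant is ordinary convergence along a filter on the index set
times `Ω` (`tendstoInMeasure_const_iff`), so the deterministic continuity theorem for Stieltjes
transforms (`tendsto_of_tendsto_stieltjes`) applies directly to the random spectral measures. That
theorem rests on Stone–Weierstrass for the functions `1/(x - z)` on the one-point compactification.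
-/

/-! ### Convergence in probability as convergence along a filter -/

/-- The filter on `ι × Ω` of the events whose probability tends to one along `l`. -/
def inMeasureFilter {ι Ω : Type*} [MeasurableSpace Ω] (P : Measure Ω) (l : Filter ι) :
    Filter (ι × Ω) where
  sets := {S | Tendsto (fun q => P {ω | (q, ω) ∉ S}) l (𝓝 0)}
  univ_sets := by simpa using tendsto_const_nhds
  sets_of_superset := by
    intro S T hS hST
    refine tendsto_of_tendsto_of_tendsto_of_le_of_le tendsto_const_nhds hS (fun _ => zero_le) ?_
    exact fun q => measure_mono fun ω hω h => hω (hST h)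
  inter_sets := by
    intro S T hS hT
    have h : Tendsto (fun q => P {ω | (q, ω) ∉ S} + P {ω | (q, ω) ∉ T}) l (𝓝 0) := by
      simpa using Tendsto.add hS hT
    refine tendsto_of_tendsto_of_tendsto_of_le_of_le tendsto_const_nhds h (fun _ => zero_le) ?_
    intro q
    refine (measure_mono ?_).trans (measure_union_le _ _)
    intro ω hω
    by_contra hc
    simp only [Set.mem_union, Set.mem_ofPred_eq, not_or, not_not] at hc
    exact hω hc

theorem mem_inMeasureFilter {ι Ω : Type*} [MeasurableSpace Ω] {P : Measure Ω} {l : Filter ι}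
    {S : Set (ι × Ω)} :
    S ∈ inMeasureFilter P l ↔ Tendsto (fun q => P {ω | (q, ω) ∉ S}) l (𝓝 0) := Iff.rfl

/-- Convergence in probability to a constant is convergence along `inMeasureFilter`. -/
theorem tendstoInMeasure_const_iff {ι Ω E : Type*} [MeasurableSpace Ω] {P : Measure Ω}
    {l : Filter ι} [PseudoEMetricSpace E] {f : ι → Ω → E} {c : E} :
    TendstoInMeasure P f l (fun _ => c) ↔
      Tendsto (fun x : ι × Ω => f x.1 x.2) (inMeasureFilter P l) (𝓝 c) := by
  rw [Metric.nhds_basis_eball.tendsto_right_iff]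
  unfold TendstoInMeasure
  refine forall₂_congr fun ε _ => ?_
  rw [Filter.Eventually, mem_inMeasureFilter]
  simp

theorem eventually_inMeasureFilter_of_eventually {ι Ω : Type*} [MeasurableSpace Ω]
    {P : Measure Ω} {l : Filter ι} {p : ι → Prop} (h : ∀ᶠ q in l, p q) :
    ∀ᶠ x in inMeasureFilter P l, p x.1 := by
  rw [Filter.Eventually, mem_inMeasureFilter]
  refine tendsto_const_nhds.congr' ?_
  filter_upwards [h] with q hq
  simp [hq]

/-! ### Density of the Cauchy kernels on the compactified line -/

theorem abs_im_le_norm_ofReal_sub (x : ℝ) (z : ℂ) : |z.im| ≤ ‖(x : ℂ) - z‖ := by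
  simpa using Complex.abs_im_le_norm ((x : ℂ) - z)

theorem ofReal_sub_ne_zero (x : ℝ) {z : ℂ} (hz : z.im ≠ 0) : (x : ℂ) - z ≠ 0 := by
  intro h
  apply hz
  simpa using congrArg Complex.im h

theorem norm_one_div_ofReal_sub_le (x : ℝ) {z : ℂ} (hz : z.im ≠ 0) :
    ‖1 / ((x : ℂ) - z)‖ ≤ 1 / |z.im| := by
  rw [norm_div, norm_one]
  exact one_div_le_one_div_of_le (abs_pos.2 hz) (abs_im_le_norm_ofReal_sub x z)

theorem continuous_one_div_ofReal_sub {z : ℂ} (hz : z.im ≠ 0) :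
    Continuous fun x : ℝ => 1 / ((x : ℂ) - z) :=
  continuous_const.div (by fun_prop) fun x => ofReal_sub_ne_zero x hz

/-- A continuous function on the line with limit `c` at infinity, extended to `OnePoint ℝ`. -/
def extendOnePoint (f : ℝ → ℂ) (c : ℂ) (hf : Continuous f) (hc : Tendsto f (cocompact ℝ) (𝓝 c)) :
    C(OnePoint ℝ, ℂ) where
  toFun := fun x => x.elim c f
  continuous_toFun := by
    rw [OnePoint.continuous_iff]
    exact ⟨by simpa [Filter.coclosedCompact_eq_cocompact] using hc, hf⟩

theorem tendsto_one_div_ofReal_sub_cocompact (z : ℂ) :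
    Tendsto (fun x : ℝ => 1 / ((x : ℂ) - z)) (cocompact ℝ) (𝓝 0) := by
  simp only [one_div]
  refine tendsto_inv₀_cobounded.comp ?_
  rw [← tendsto_norm_atTop_iff_cobounded]
  refine tendsto_atTop_mono (f := fun x : ℝ => ‖x‖ - ‖z‖) (fun x => ?_) ?_
  · simpa using norm_sub_norm_le (x : ℂ) z
  · exact tendsto_atTop_add_const_right _ _ tendsto_norm_cocompact_atTop

/-- The function `x ↦ 1 / (x - z)` on the one-point compactification of the line. -/
noncomputable def cauchyKernel (z : {z : ℂ // z.im ≠ 0}) : C(OnePoint ℝ, ℂ) :=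
  extendOnePoint _ 0 (continuous_one_div_ofReal_sub z.2) (tendsto_one_div_ofReal_sub_cocompact z)

@[simp] theorem cauchyKernel_coe (z : {z : ℂ // z.im ≠ 0}) (x : ℝ) :
    cauchyKernel z (x : OnePoint ℝ) = 1 / ((x : ℂ) - z) := rfl

@[simp] theorem cauchyKernel_infty (z : {z : ℂ // z.im ≠ 0}) :
    cauchyKernel z OnePoint.infty = 0 := rfl

theorem norm_cauchyKernel_le (z : {z : ℂ // z.im ≠ 0}) : ‖cauchyKernel z‖ ≤ 1 / |z.1.im| := by
  rw [ContinuousMap.norm_le _ (by positivity)]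
  intro x
  induction x using OnePoint.rec with
  | infty => simp
  | coe x => exact norm_one_div_ofReal_sub_le x z.2

/-- The scalar resolvent identity. It turns a product of two distinct kernels into a linear
combination of them, so that their span is almost an algebra. -/
theorem cauchyKernel_sub (z w : {z : ℂ // z.im ≠ 0}) :
    cauchyKernel z - cauchyKernel w = (z.1 - w.1) • (cauchyKernel z * cauchyKernel w) := by
  ext x
  induction x using OnePoint.rec with
  | infty => simp
  | coe x =>
    have h1 := ofReal_sub_ne_zero x z.2
    have h2 := ofReal_sub_ne_zero x w.2
    simp only [ContinuousMap.sub_apply, cauchyKernel_coe, ContinuousMap.smul_apply,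
      ContinuousMap.mul_apply, smul_eq_mul]
    field_simp
    ring

theorem star_cauchyKernel (z : {z : ℂ // z.im ≠ 0}) :
    star (cauchyKernel z) = cauchyKernel ⟨star z.1, by simpa using z.2⟩ := by
  ext x
  induction x using OnePoint.rec with
  | infty => simp
  | coe x => simp

/-- The span of the constants and the Cauchy kernels. -/
noncomputable def cauchySpan : Submodule ℂ C(OnePoint ℝ, ℂ) :=
  Submodule.span ℂ (insert 1 (Set.range cauchyKernel))

theorem cauchyKernel_mem (z : {z : ℂ // z.im ≠ 0}) : cauchyKernel z ∈ cauchySpan :=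
  Submodule.subset_span (Set.mem_insert_of_mem _ ⟨z, rfl⟩)

theorem cauchyKernel_mul_mem_of_ne {z w : {z : ℂ // z.im ≠ 0}} (h : z ≠ w) :
    cauchyKernel z * cauchyKernel w ∈ cauchySpan := by
  have hne : z.1 - w.1 ≠ 0 := sub_ne_zero.2 fun e => h (Subtype.ext e)
  have : cauchyKernel z * cauchyKernel w
      = (z.1 - w.1)⁻¹ • (cauchyKernel z - cauchyKernel w) := by
    rw [cauchyKernel_sub, smul_smul, inv_mul_cancel₀ hne, one_smul]
  rw [this]
  exact Submodule.smul_mem _ _ (Submodule.sub_mem _ (cauchyKernel_mem z) (cauchyKernel_mem w))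

/-- Only the square of a kernel escapes the resolvent identity; it is a uniform limit of products of
distinct kernels, which is why the closure of the span is needed. -/
theorem cauchyKernel_mul_mem (z w : {z : ℂ // z.im ≠ 0}) :
    cauchyKernel z * cauchyKernel w ∈ cauchySpan.topologicalClosure := by
  by_cases h : z = w
  · subst h
    -- Moving the pole horizontally keeps its imaginary part, hence the sup bound on the kernel,
    -- fixed.
    let u : ℕ → {z : ℂ // z.im ≠ 0} := fun k =>
      ⟨z.1 + ((1 / ((k : ℝ) + 1) : ℝ) : ℂ), by
        rw [Complex.add_im, Complex.ofReal_im, add_zero]; exact z.2⟩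
    have him : ∀ k, (u k).1.im = z.1.im := fun k => by
      rw [Complex.add_im, Complex.ofReal_im, add_zero]
    have hpos : ∀ k : ℕ, (0 : ℝ) < 1 / ((k : ℝ) + 1) := fun k => by positivity
    have hu : Tendsto (fun k => cauchyKernel (u k)) atTop (𝓝 (cauchyKernel z)) := by
      rw [tendsto_iff_norm_sub_tendsto_zero]
      have h0 : Tendsto (fun k : ℕ => (1 / ((k : ℝ) + 1)) * (1 / |z.1.im| * (1 / |z.1.im|)))
          atTop (𝓝 0) := by
        simpa using tendsto_one_div_add_atTop_nhds_zero_nat.mul_const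
          (1 / |z.1.im| * (1 / |z.1.im|))
      refine squeeze_zero (fun _ => norm_nonneg _) (fun k => ?_) h0
      rw [cauchyKernel_sub, norm_smul]
      have e : ‖(u k).1 - z.1‖ = 1 / ((k : ℝ) + 1) := by
        simp only [u, add_sub_cancel_left, Complex.norm_real]
        exact abs_of_pos (hpos k)
      rw [e]
      refine mul_le_mul_of_nonneg_left ((norm_mul_le _ _).trans ?_) (hpos k).le
      have h1 := norm_cauchyKernel_le (u k)
      rw [him] at h1
      exact mul_le_mul h1 (norm_cauchyKernel_le z) (norm_nonneg _) (by positivity)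
    refine mem_closure_of_tendsto (hu.const_mul (cauchyKernel z)) (Eventually.of_forall fun k => ?_)
    refine cauchyKernel_mul_mem_of_ne fun e => (hpos k).ne' ?_
    have := congrArg (fun w : {z : ℂ // z.im ≠ 0} => w.1.re) e
    simp only [u, Complex.add_re, Complex.ofReal_re] at this
    linarith
  · exact Submodule.le_topologicalClosure _ (cauchyKernel_mul_mem_of_ne h)

theorem cauchySpan_mul_mem {f g : C(OnePoint ℝ, ℂ)} (hf : f ∈ cauchySpan) (hg : g ∈ cauchySpan) :
    f * g ∈ cauchySpan.topologicalClosure := by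
  induction hf, hg using Submodule.span_induction₂ with
  | mem_mem x y hx hy =>
    rcases hx with rfl | ⟨z, rfl⟩
    · rw [one_mul]; exact Submodule.le_topologicalClosure _ (Submodule.subset_span hy)
    · rcases hy with rfl | ⟨w, rfl⟩
      · rw [mul_one]; exact Submodule.le_topologicalClosure _ (cauchyKernel_mem z)
      · exact cauchyKernel_mul_mem z w
  | zero_left y hy => simp
  | zero_right x hx => simp
  | add_left x y z _ _ _ h1 h2 => rw [add_mul]; exact Submodule.add_mem _ h1 h2
  | add_right x y z _ _ _ h1 h2 => rw [mul_add]; exact Submodule.add_mem _ h1 h2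
  | smul_left r x y _ _ h => rw [smul_mul_assoc]; exact Submodule.smul_mem _ _ h
  | smul_right r x y _ _ h => rw [mul_smul_comm]; exact Submodule.smul_mem _ _ h

theorem cauchySpan_star_mem {f : C(OnePoint ℝ, ℂ)} (hf : f ∈ cauchySpan) :
    star f ∈ cauchySpan := by
  induction hf using Submodule.span_induction with
  | mem x hx =>
    rcases hx with rfl | ⟨z, rfl⟩
    · rw [star_one]; exact Submodule.subset_span (Set.mem_insert _ _)
    · rw [star_cauchyKernel]; exact cauchyKernel_mem _
  | zero => simp
  | add x y _ _ h1 h2 => rw [star_add]; exact Submodule.add_mem _ h1 h2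
  | smul r x _ h => rw [star_smul]; exact Submodule.smul_mem _ _ h

/-- The closure of `cauchySpan`, as a star subalgebra. -/
noncomputable def cauchyAlgebra : StarSubalgebra ℂ C(OnePoint ℝ, ℂ) where
  carrier := cauchySpan.topologicalClosure
  mul_mem' := by
    intro f g hf hg
    have h := map_mem_closure₂ continuous_mul hf hg
      (u := (cauchySpan.topologicalClosure : Set C(OnePoint ℝ, ℂ)))
      fun a ha b hb => cauchySpan_mul_mem ha hb
    rwa [(Submodule.isClosed_topologicalClosure cauchySpan).closure_eq] at h
  add_mem' := fun hf hg => Submodule.add_mem _ hf hg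
  algebraMap_mem' := by
    intro r
    rw [Algebra.algebraMap_eq_smul_one]
    exact Submodule.smul_mem _ _ (Submodule.le_topologicalClosure _
      (Submodule.subset_span (Set.mem_insert _ _)))
  star_mem' := by
    intro f hf
    exact map_mem_closure continuous_star hf fun a ha => cauchySpan_star_mem ha

/-- The single kernel with pole at `I` is already injective: it vanishes only at infinity and is the
inverse of an injective function elsewhere. -/
theorem cauchyAlgebra_separatesPoints :
    cauchyAlgebra.toSubalgebra.SeparatesPoints := by
  have hI : Complex.I.im ≠ 0 := by simp
  have key : ∀ x y : OnePoint ℝ, cauchyKernel ⟨Complex.I, hI⟩ x = cauchyKernel ⟨Complex.I, hI⟩ y →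
      x = y := by
    intro x y h
    induction x using OnePoint.rec with
    | infty =>
      induction y using OnePoint.rec with
      | infty => rfl
      | coe y =>
        have := one_div_ne_zero (ofReal_sub_ne_zero y hI)
        exact absurd h.symm this
    | coe x =>
      induction y using OnePoint.rec with
      | infty =>
        have := one_div_ne_zero (ofReal_sub_ne_zero x hI)
        exact absurd h this
      | coe y =>
        simp only [cauchyKernel_coe, one_div, inv_inj, sub_left_inj, Complex.ofReal_inj] at h
        rw [h]
  intro x y hxy
  refine ⟨_, ⟨cauchyKernel ⟨Complex.I, hI⟩, ?_, rfl⟩, fun h => hxy (key x y h)⟩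
  exact Submodule.le_topologicalClosure _ (cauchyKernel_mem _)

theorem cauchySpan_topologicalClosure : cauchySpan.topologicalClosure = ⊤ := by
  have h := ContinuousMap.starSubalgebra_topologicalClosure_eq_top_of_separatesPoints _
    cauchyAlgebra_separatesPoints
  rw [eq_top_iff]
  intro f _
  have hf : f ∈ cauchyAlgebra.topologicalClosure := by rw [h]; trivial
  have hf' : f ∈ closure (cauchySpan.topologicalClosure : Set C(OnePoint ℝ, ℂ)) := hf
  rwa [(Submodule.isClosed_topologicalClosure cauchySpan).closure_eq] at hf'

/-! ### From Stieltjes transforms to weak convergence -/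

theorem integrable_onePoint (ν : Measure ℝ) [IsFiniteMeasure ν] (f : C(OnePoint ℝ, ℂ)) :
    Integrable (fun x : ℝ => f x) ν := by
  refine Integrable.of_bound (C := ‖f‖) ?_ (Eventually.of_forall fun x => f.norm_coe_le_norm x)
  exact (f.continuous.comp OnePoint.continuous_coe).aestronglyMeasurable

theorem norm_integral_onePoint_sub_le (ν : ProbabilityMeasure ℝ) (f g : C(OnePoint ℝ, ℂ)) :
    ‖∫ x : ℝ, f x ∂(ν : Measure ℝ) - ∫ x : ℝ, g x ∂(ν : Measure ℝ)‖ ≤ ‖f - g‖ := by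
  rw [← integral_sub (integrable_onePoint _ f) (integrable_onePoint _ g)]
  have := norm_integral_le_of_norm_le_const (μ := (ν : Measure ℝ)) (C := ‖f - g‖)
    (f := fun x : ℝ => f x - g x) (Eventually.of_forall fun x => (f - g).norm_coe_le_norm x)
  simpa using this

section Weak

variable {α : Type*} {F : Filter α} {ν : α → ProbabilityMeasure ℝ} {μ : ProbabilityMeasure ℝ}

/-- Integration against a probability measure is 1-Lipschitz in the sup norm, uniformly over the
family, so convergence passes from the dense span to all test functions. The constants converge
because every mass is one. -/
theorem tendsto_integral_onePoint_of_tendsto_stieltjes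
    (h : ∀ z : ℂ, z.im ≠ 0 →
      Tendsto (fun a => stieltjes (ν a) z) F (𝓝 (stieltjes (μ : Measure ℝ) z)))
    (f : C(OnePoint ℝ, ℂ)) :
    Tendsto (fun a => ∫ x : ℝ, f x ∂(ν a : Measure ℝ)) F (𝓝 (∫ x : ℝ, f x ∂(μ : Measure ℝ))) := by
  have hspan : ∀ g ∈ cauchySpan, Tendsto (fun a => ∫ x : ℝ, g x ∂(ν a : Measure ℝ)) F
      (𝓝 (∫ x : ℝ, g x ∂(μ : Measure ℝ))) := by
    intro g hg
    induction hg using Submodule.span_induction with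
    | mem x hx =>
      rcases hx with rfl | ⟨z, rfl⟩
      · simpa using tendsto_const_nhds
      · simpa only [stieltjes_eq, cauchyKernel_coe] using h z.1 z.2
    | zero => simpa using tendsto_const_nhds
    | add x y _ _ h1 h2 =>
      simp only [ContinuousMap.add_apply]
      rw [integral_add (integrable_onePoint _ x) (integrable_onePoint _ y)]
      simp_rw [fun a => integral_add (integrable_onePoint (ν a : Measure ℝ) x)
        (integrable_onePoint (ν a : Measure ℝ) y)]
      exact h1.add h2
    | smul r x _ h =>
      simp only [ContinuousMap.smul_apply, integral_smul]
      exact h.const_smul r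
  rw [Metric.tendsto_nhds]
  intro ε hε
  have hf : f ∈ closure (cauchySpan : Set C(OnePoint ℝ, ℂ)) := by
    have : f ∈ cauchySpan.topologicalClosure := by
      rw [cauchySpan_topologicalClosure]; trivial
    exact this
  obtain ⟨g, hg, hfg⟩ := Metric.mem_closure_iff.1 hf (ε / 3) (by positivity)
  rw [dist_eq_norm] at hfg
  filter_upwards [Metric.tendsto_nhds.1 (hspan g hg) (ε / 3) (by positivity)] with a ha
  have h1 := norm_integral_onePoint_sub_le (ν a) f g
  have h2 := norm_integral_onePoint_sub_le μ f g
  rw [← dist_eq_norm] at h1 h2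
  rw [dist_comm] at h2
  calc _ ≤ _ := dist_triangle4 _ (∫ x : ℝ, g x ∂(ν a : Measure ℝ))
          (∫ x : ℝ, g x ∂(μ : Measure ℝ)) _
    _ < ε := by linarith

theorem tendsto_integral_of_hasCompactSupport
    (h : ∀ z : ℂ, z.im ≠ 0 →
      Tendsto (fun a => stieltjes (ν a) z) F (𝓝 (stieltjes (μ : Measure ℝ) z)))
    {f : ℝ → ℝ} (hf : Continuous f) (hc : HasCompactSupport f) :
    Tendsto (fun a => ∫ x : ℝ, f x ∂(ν a : Measure ℝ)) F (𝓝 (∫ x : ℝ, f x ∂(μ : Measure ℝ))) := by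
  have hlim : Tendsto (fun x => (f x : ℂ)) (cocompact ℝ) (𝓝 0) := by
    have := (Complex.continuous_ofReal.tendsto 0).comp
      (hc.is_zero_at_infty)
    simpa [Function.comp_def] using this
  have key := tendsto_integral_onePoint_of_tendsto_stieltjes h
    (extendOnePoint (fun x => (f x : ℂ)) 0 (by fun_prop) hlim)
  have e : ∀ ρ : Measure ℝ,
      ∫ x : ℝ, (extendOnePoint (fun x => (f x : ℂ)) 0 (by fun_prop) hlim) x ∂ρ
      = ((∫ x, f x ∂ρ : ℝ) : ℂ) := fun ρ => integral_ofReal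
  simp only [e] at key
  have := (Complex.continuous_re.tendsto _).comp key
  simpa [Function.comp_def] using this

/-- Vague convergence becomes weak convergence because the limit has mass one: a cutoff capturing
almost all of `μ` eventually captures almost all of `ν a`, so no tightness of the family has to be
assumed. -/
theorem tendsto_of_tendsto_stieltjes
    (h : ∀ z : ℂ, z.im ≠ 0 →
      Tendsto (fun a => stieltjes (ν a) z) F (𝓝 (stieltjes (μ : Measure ℝ) z))) :
    Tendsto ν F (𝓝 μ) := by
  rw [ProbabilityMeasure.tendsto_iff_forall_integral_tendsto]
  intro f
  rw [Metric.tendsto_nhds]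
  intro ε hε
  set c : ℝ := ‖f‖
  have hc0 : 0 ≤ c := norm_nonneg _
  -- The `c + 1` makes sense also for `f = 0` and gives the strict bound `c * δ < ε / 4`; the final
  -- budget is `2δc + δc + ε/4`.
  set δ : ℝ := ε / (4 * (c + 1)) with hδ
  have hδ0 : 0 < δ := by positivity
  obtain ⟨K, hK, hKμ⟩ := isTightMeasureSet_iff_exists_isCompact_measure_compl_le.1
    (isTightMeasureSet_singleton (μ := (μ : Measure ℝ))) (ENNReal.ofReal δ) (by simpa using hδ0)
  replace hKμ := hKμ _ rfl
  obtain ⟨χ, hχ1, -, hχc, hχ⟩ := exists_continuous_one_zero_of_isCompact hK isClosed_empty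
    (Set.disjoint_empty K)
  have hint : ∀ (ρ : ProbabilityMeasure ℝ), Integrable (fun x => χ x) (ρ : Measure ℝ) := fun ρ =>
    Integrable.of_bound (C := 1) χ.continuous.aestronglyMeasurable
      (Eventually.of_forall fun x => by
        rw [Real.norm_eq_abs, abs_of_nonneg (hχ x).1]; exact (hχ x).2)
  have hfint : ∀ (ρ : ProbabilityMeasure ℝ), Integrable (fun x => f x) (ρ : Measure ℝ) :=
    fun ρ => f.integrable _
  have hfχint : ∀ (ρ : ProbabilityMeasure ℝ), Integrable (fun x => f x * χ x) (ρ : Measure ℝ) :=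
    fun ρ => by
      refine Integrable.of_bound (C := c) (by fun_prop) (Eventually.of_forall fun x => ?_)
      rw [norm_mul, Real.norm_eq_abs (χ x), abs_of_nonneg (hχ x).1]
      exact (mul_le_of_le_one_right (norm_nonneg _) (hχ x).2).trans (f.norm_coe_le_norm x)
  have hcut : ∀ ρ : ProbabilityMeasure ℝ,
      |∫ x, f x ∂(ρ : Measure ℝ) - ∫ x, f x * χ x ∂(ρ : Measure ℝ)|
        ≤ c * (1 - ∫ x, χ x ∂(ρ : Measure ℝ)) := by
    intro ρ
    rw [← integral_sub (hfint ρ) (hfχint ρ)]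
    have e : c * (1 - ∫ x, χ x ∂(ρ : Measure ℝ)) = ∫ x, c * (1 - χ x) ∂(ρ : Measure ℝ) := by
      rw [integral_const_mul, integral_sub (integrable_const _) (hint ρ)]
      simp
    rw [e, ← Real.norm_eq_abs]
    refine norm_integral_le_of_norm_le (((integrable_const _).sub (hint ρ)).const_mul c)
      (Eventually.of_forall fun x => ?_)
    have : f x - f x * χ x = f x * (1 - χ x) := by ring
    rw [this, norm_mul, Real.norm_eq_abs (1 - χ x), abs_of_nonneg (sub_nonneg.2 (hχ x).2)]
    exact mul_le_mul_of_nonneg_right (f.norm_coe_le_norm x) (sub_nonneg.2 (hχ x).2)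
  have hμχ : 1 - ∫ x, χ x ∂(μ : Measure ℝ) ≤ δ := by
    have h1 : (μ : Measure ℝ).real K ≤ ∫ x, χ x ∂(μ : Measure ℝ) := by
      rw [← integral_indicator_one hK.measurableSet]
      refine integral_mono ((integrable_const (1 : ℝ)).indicator hK.measurableSet) (hint μ) ?_
      intro x
      by_cases hx : x ∈ K
      · simp [hx, hχ1 hx]
      · simpa [hx] using (hχ x).1
    have h2 : (μ : Measure ℝ).real Kᶜ ≤ δ :=
      ENNReal.toReal_le_of_le_ofReal hδ0.le hKμ
    have h3 := probReal_compl_eq_one_sub (μ := (μ : Measure ℝ)) hK.measurableSet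
    linarith
  have t1 := tendsto_integral_of_hasCompactSupport h χ.continuous hχc
  have t2 := tendsto_integral_of_hasCompactSupport h (f := fun x => f x * χ x) (by fun_prop)
    hχc.mul_left
  filter_upwards [Metric.tendsto_nhds.1 t1 δ hδ0, Metric.tendsto_nhds.1 t2 (ε / 4) (by positivity)]
    with a h1 h2
  rw [Real.dist_eq] at h1 h2 ⊢
  have h3 := hcut (ν a)
  have h4 := hcut μ
  have h5 : c * (1 - ∫ x, χ x ∂(ν a : Measure ℝ)) ≤ c * (2 * δ) :=
    mul_le_mul_of_nonneg_left (by linarith [(abs_lt.1 h1).1]) hc0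
  have h6 := mul_le_mul_of_nonneg_left hμχ hc0
  have h7 : (c + 1) * δ = ε / 4 := by rw [hδ]; field_simp
  have h8 : c * δ < ε / 4 := by nlinarith
  rw [abs_le] at h3 h4
  rw [abs_lt] at h2 ⊢
  constructor <;> linarith [h3.1, h3.2, h4.1, h4.2, h2.1, h2.2]

end Weak

/-- The Stieltjes transform determines a probability measure. -/
theorem eq_of_stieltjes_eq {μ ν : Measure ℝ} [IsProbabilityMeasure μ] [IsProbabilityMeasure ν]
    (h : ∀ z : ℂ, z.im ≠ 0 → stieltjes ν z = stieltjes μ z) : ν = μ := by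
  let m : ProbabilityMeasure ℝ := ⟨μ, inferInstance⟩
  let n : ProbabilityMeasure ℝ := ⟨ν, inferInstance⟩
  -- The continuity theorem is applied to a constant family, whose limit is unique.
  have ht : Tendsto (fun _ : Unit => n) ⊤ (𝓝 m) :=
    tendsto_of_tendsto_stieltjes fun z hz => by
      have : stieltjes (n : Measure ℝ) z = stieltjes (m : Measure ℝ) z := h z hz
      rw [this]
      exact tendsto_const_nhds
  have : n = m := tendsto_nhds_unique tendsto_const_nhds ht
  exact congrArg Subtype.val this

/-! ### The Stieltjes transform of the semicircle law -/

theorem integral_sin_nat_mul_sin (k : ℕ) :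
    ∫ θ in (0 : ℝ)..Real.pi, Real.sin (((k : ℝ) + 1) * θ) * Real.sin θ
      = if k = 0 then Real.pi / 2 else 0 := by
  have hcos : ∀ m : ℕ, m ≠ 0 → ∫ θ in (0 : ℝ)..Real.pi, Real.cos ((m : ℝ) * θ) = 0 := by
    intro m hm
    have hm' : (m : ℝ) ≠ 0 := by exact_mod_cast hm
    rw [intervalIntegral.integral_comp_mul_left (fun x => Real.cos x) hm', integral_cos]
    simp [Real.sin_nat_mul_pi]
  have e : ∀ θ : ℝ, Real.sin (((k : ℝ) + 1) * θ) * Real.sin θ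
      = (Real.cos ((k : ℝ) * θ) - Real.cos (((k + 2 : ℕ) : ℝ) * θ)) / 2 := by
    intro θ
    have h1 : (k : ℝ) * θ = ((k : ℝ) + 1) * θ - θ := by ring
    have h2 : ((k + 2 : ℕ) : ℝ) * θ = ((k : ℝ) + 1) * θ + θ := by push_cast; ring
    rw [h1, h2, Real.cos_sub, Real.cos_add]
    ring
  simp_rw [e]
  rw [intervalIntegral.integral_div, intervalIntegral.integral_sub
    (Continuous.intervalIntegrable (by fun_prop) _ _)
    (Continuous.intervalIntegrable (by fun_prop) _ _), hcos (k + 2) (by omega)]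
  by_cases hk : k = 0
  · subst hk; simp
  · rw [hcos k hk]; simp [hk]

/-- This is the generating function of the Chebyshev polynomials of the second kind. It comes from
writing the sine through `exp (± θ I)` and subtracting two geometric series. -/
theorem hasSum_pow_mul_sin {ζ : ℂ} (hζ : ‖ζ‖ < 1) (θ : ℝ) :
    HasSum (fun k : ℕ => ζ ^ k * (Real.sin (((k : ℝ) + 1) * θ) * Real.sin θ : ℝ))
      ((Real.sin θ : ℂ) ^ 2 / (1 - 2 * ζ * Real.cos θ + ζ ^ 2)) := by
  set q : ℂ := Complex.exp (θ * Complex.I) with hq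
  set r : ℂ := Complex.exp (-θ * Complex.I) with hr
  have hqr : q * r = 1 := by rw [hq, hr, ← Complex.exp_add]; simp
  have nq : ‖q‖ = 1 := Complex.norm_exp_ofReal_mul_I θ
  have nr : ‖r‖ = 1 := by
    rw [hr, ← Complex.ofReal_neg]; exact Complex.norm_exp_ofReal_mul_I (-θ)
  have h1 : ‖ζ * q‖ < 1 := by rw [norm_mul, nq, mul_one]; exact hζ
  have h2 : ‖ζ * r‖ < 1 := by rw [norm_mul, nr, mul_one]; exact hζ
  have g1 := (hasSum_geometric_of_norm_lt_one h1).mul_left q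
  have g2 := (hasSum_geometric_of_norm_lt_one h2).mul_left r
  have g := ((g1.sub g2).mul_left (-Complex.I / 2)).mul_right (Real.sin θ : ℂ)
  have hcos : (Real.cos θ : ℂ) = (q + r) / 2 := by
    rw [Complex.ofReal_cos, Complex.cos]
  have hsin : (Real.sin θ : ℂ) = (r - q) * Complex.I / 2 := by
    rw [Complex.ofReal_sin, Complex.sin]
  have d1 : 1 - ζ * q ≠ 0 := fun h => by
    rw [← sub_eq_zero.1 h] at h1; simp at h1
  have d2 : 1 - ζ * r ≠ 0 := fun h => by
    rw [← sub_eq_zero.1 h] at h2; simp at h2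
  have eterm : ∀ k : ℕ, ζ ^ k * ((Real.sin (((k : ℝ) + 1) * θ) * Real.sin θ : ℝ) : ℂ)
      = -Complex.I / 2 * (q * (ζ * q) ^ k - r * (ζ * r) ^ k) * (Real.sin θ : ℂ) := by
    intro k
    have e1 : q * (ζ * q) ^ k = ζ ^ k * Complex.exp ((((k : ℝ) + 1) * θ : ℝ) * Complex.I) := by
      rw [mul_pow, hq, ← Complex.exp_nat_mul, mul_left_comm, ← Complex.exp_add]
      congr 2; push_cast; ring
    have e2 : r * (ζ * r) ^ k = ζ ^ k * Complex.exp (-(((k : ℝ) + 1) * θ : ℝ) * Complex.I) := by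
      rw [mul_pow, hr, ← Complex.exp_nat_mul, mul_left_comm, ← Complex.exp_add]
      congr 2; push_cast; ring
    rw [e1, e2, Complex.ofReal_mul, Complex.ofReal_sin (((k : ℝ) + 1) * θ), Complex.sin]
    ring
  have elim : (Real.sin θ : ℂ) ^ 2 / (1 - 2 * ζ * Real.cos θ + ζ ^ 2)
      = -Complex.I / 2 * (q * (1 - ζ * q)⁻¹ - r * (1 - ζ * r)⁻¹) * (Real.sin θ : ℂ) := by
    have hden : 1 - 2 * ζ * Real.cos θ + ζ ^ 2 = (1 - ζ * q) * (1 - ζ * r) := by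
      rw [hcos]; linear_combination -ζ ^ 2 * hqr
    rw [hden, sq, mul_div_right_comm]
    congr 1
    rw [hsin, div_eq_iff (mul_ne_zero d1 d2)]
    linear_combination (Complex.I / 2 * q * (1 - ζ * r)) * mul_inv_cancel₀ d1
      - (Complex.I / 2 * r * (1 - ζ * q)) * mul_inv_cancel₀ d2
  rw [elim]
  simpa only [eterm] using g

/-- By orthogonality only the term `k = 0` of the series survives integration, so the value does not
depend on `ζ`. -/
theorem integral_sin_sq_div {ζ : ℂ} (hζ : ‖ζ‖ < 1) :
    ∫ θ in (0 : ℝ)..Real.pi, (Real.sin θ : ℂ) ^ 2 / (1 - 2 * ζ * Real.cos θ + ζ ^ 2)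
      = (Real.pi : ℂ) / 2 := by
  have key := intervalIntegral.hasSum_integral_of_dominated_convergence
    (μ := volume) (a := 0) (b := Real.pi)
    (F := fun (k : ℕ) (θ : ℝ) => ζ ^ k * (Real.sin (((k : ℝ) + 1) * θ) * Real.sin θ : ℝ))
    (f := fun θ => (Real.sin θ : ℂ) ^ 2 / (1 - 2 * ζ * Real.cos θ + ζ ^ 2))
    (fun k _ => ‖ζ‖ ^ k)
    (fun k => (by fun_prop : Continuous _).aestronglyMeasurable)
    (fun k => Eventually.of_forall fun θ _ => by
      rw [norm_mul, norm_pow, Complex.norm_real, norm_mul]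
      refine mul_le_of_le_one_right (by positivity) ?_
      exact mul_le_one₀ (Real.abs_sin_le_one _) (norm_nonneg _) (Real.abs_sin_le_one _))
    (Eventually.of_forall fun θ _ => summable_geometric_of_lt_one (norm_nonneg _) hζ)
    (by simp)
    (Eventually.of_forall fun θ _ => hasSum_pow_mul_sin hζ θ)
  have e : ∀ k : ℕ, ∫ θ in (0 : ℝ)..Real.pi,
      ζ ^ k * (Real.sin (((k : ℝ) + 1) * θ) * Real.sin θ : ℝ)
        = if k = 0 then (Real.pi / 2 : ℂ) else 0 := by
    intro k
    rw [intervalIntegral.integral_const_mul, intervalIntegral.integral_ofReal,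
      integral_sin_nat_mul_sin]
    by_cases hk : k = 0
    · subst hk; simp
    · simp [hk]
  simp only [e] at key
  exact key.unique (hasSum_ite_eq 0 _)

section Semicircle

variable {v : ℝ}

/-- Outside the support the radicand is negative and `Real.sqrt` is zero by convention, so the
truncation is automatic. -/
theorem semicircleDensity_eq (hv : 0 < v) (x : ℝ) :
    semicircleDensity v x = 1 / (2 * Real.pi * v ^ 2) * √(4 * v ^ 2 - x ^ 2) := by
  unfold semicircleDensity
  split_ifs with h
  · rfl
  · rw [Real.sqrt_eq_zero_of_nonpos]
    have : 2 * v < |x| := not_le.1 h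
    nlinarith [sq_abs x]

theorem continuous_semicircleDensity (hv : 0 < v) : Continuous (semicircleDensity v) := by
  rw [funext (semicircleDensity_eq hv)]
  fun_prop

theorem semicircleDensity_nonneg (hv : 0 < v) (x : ℝ) : 0 ≤ semicircleDensity v x := by
  rw [semicircleDensity_eq hv]
  positivity

theorem semicircleDensity_eq_zero {x : ℝ} (hx : x ∉ Set.Icc (-(2 * v)) (2 * v)) :
    semicircleDensity v x = 0 := by
  unfold semicircleDensity
  rw [if_neg, mul_zero]
  rwa [abs_le]

/-- The substitution is `x = -2v cos θ`, with the sign chosen so that `x` increases with `θ` on `[0,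
π]`. -/
theorem integral_semicircleDensity_smul {E : Type*} [NormedAddCommGroup E] [NormedSpace ℝ E]
    (hv : 0 < v) {f : ℝ → E} (hf : Continuous f) :
    ∫ x, semicircleDensity v x • f x
      = (2 / Real.pi) • ∫ θ in (0 : ℝ)..Real.pi, Real.sin θ ^ 2 • f (-(2 * v * Real.cos θ)) := by
  have h1 : ∫ x, semicircleDensity v x • f x
      = ∫ x in (-(2 * v))..(2 * v), semicircleDensity v x • f x := by
    rw [intervalIntegral.integral_of_le (by linarith), ← integral_Icc_eq_integral_Ioc,
      setIntegral_eq_integral_of_forall_compl_eq_zero]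
    intro x hx
    rw [semicircleDensity_eq_zero hx, zero_smul]
  have h2 := intervalIntegral.integral_deriv_smul_comp' (a := 0) (b := Real.pi)
    (f := fun θ => -(2 * v * Real.cos θ)) (f' := fun θ => 2 * v * Real.sin θ)
    (g := fun x => semicircleDensity v x • f x)
    (fun θ _ => by
      have := ((Real.hasDerivAt_cos θ).const_mul (2 * v)).neg
      rwa [mul_neg, neg_neg] at this)
    (by fun_prop) ((continuous_semicircleDensity hv).smul hf).continuousOn
  simp only [Real.cos_zero, Real.cos_pi, mul_one, mul_neg, neg_neg] at h2
  rw [h1, ← h2, ← intervalIntegral.integral_smul]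
  refine intervalIntegral.integral_congr fun θ hθ => ?_
  rw [Set.uIcc_of_le Real.pi_pos.le] at hθ
  have hs : 0 ≤ Real.sin θ := Real.sin_nonneg_of_mem_Icc hθ
  have hsq : √(4 * v ^ 2 - (-(2 * v * Real.cos θ)) ^ 2) = 2 * v * Real.sin θ := by
    rw [← Real.sqrt_sq (by positivity : 0 ≤ 2 * v * Real.sin θ)]
    congr 1
    have := Real.sin_sq_add_cos_sq θ
    linear_combination (-4 * v ^ 2) * this
  simp only [Function.comp, smul_smul]
  congr 1
  rw [semicircleDensity_eq hv, hsq]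
  field_simp

theorem integral_semicircleMeasure {E : Type*} [NormedAddCommGroup E] [NormedSpace ℝ E]
    (hv : 0 < v) {f : ℝ → E} (hf : Continuous f) :
    ∫ x, f x ∂(semicircleMeasure v)
      = (2 / Real.pi) • ∫ θ in (0 : ℝ)..Real.pi, Real.sin θ ^ 2 • f (-(2 * v * Real.cos θ)) := by
  rw [← integral_semicircleDensity_smul hv hf, semicircleMeasure,
    integral_withDensity_eq_integral_toReal_smul
      (continuous_semicircleDensity hv).measurable.ennreal_ofReal
      (Eventually.of_forall fun x => ENNReal.ofReal_lt_top)]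
  refine integral_congr_ae (Eventually.of_forall fun x => ?_)
  simp only [ENNReal.toReal_ofReal (semicircleDensity_nonneg hv x)]

theorem integrable_semicircleDensity (hv : 0 < v) : Integrable (semicircleDensity v) :=
  (continuous_semicircleDensity hv).integrable_of_hasCompactSupport
    (HasCompactSupport.intro isCompact_Icc fun _ hx => semicircleDensity_eq_zero hx)

theorem semicircleMeasure_apply (hv : 0 < v) {s : Set ℝ} (hs : MeasurableSet s) :
    semicircleMeasure v s = ENNReal.ofReal (∫ x in s, semicircleDensity v x) := by
  rw [semicircleMeasure, withDensity_apply _ hs, ofReal_integral_eq_lintegral_ofReal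
    (integrable_semicircleDensity hv).integrableOn
    (Eventually.of_forall fun x => semicircleDensity_nonneg hv x)]

theorem isProbabilityMeasure_semicircleMeasure (hv : 0 < v) :
    IsProbabilityMeasure (semicircleMeasure v) := by
  refine ⟨?_⟩
  have h := integral_semicircleDensity_smul hv (f := fun _ => (1 : ℝ)) continuous_const
  simp only [smul_eq_mul, mul_one, integral_sin_sq] at h
  rw [semicircleMeasure_apply hv MeasurableSet.univ, setIntegral_univ, h]
  have hpi := Real.pi_ne_zero
  simp only [Real.sin_zero, Real.cos_zero, Real.sin_pi, Real.cos_pi]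
  rw [← ENNReal.ofReal_one]
  congr 1
  field_simp
  ring

theorem semicircleMeasure_real_Iic (hv : 0 < v) (t : ℝ) :
    (semicircleMeasure v).real (Set.Iic t) = semicircleCDF v t := by
  rw [measureReal_def, semicircleMeasure_apply hv measurableSet_Iic, semicircleCDF,
    ENNReal.toReal_ofReal (integral_nonneg fun x => semicircleDensity_nonneg hv x)]

/-- The two roots have product 1, so one lies inside the unit circle unless both lie on it. In that
case they are conjugate and their sum `-u` is real. -/
theorem exists_root_norm_lt_one {u : ℂ} (hu : u.im ≠ 0) :
    ∃ ζ : ℂ, ‖ζ‖ < 1 ∧ ζ ^ 2 + u * ζ + 1 = 0 := by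
  obtain ⟨s, hs⟩ := IsSepClosed.exists_pow_nat_eq (u ^ 2 - 4) 2
  set a : ℂ := (-u + s) / 2 with ha
  set b : ℂ := (-u - s) / 2 with hb
  have hab : a * b = 1 := by rw [ha, hb]; linear_combination (-1 / 4 : ℂ) * hs
  have hsum : a + b = -u := by rw [ha, hb]; ring
  have hra : a ^ 2 + u * a + 1 = 0 := by linear_combination a * hsum - hab
  have hrb : b ^ 2 + u * b + 1 = 0 := by linear_combination b * hsum - hab
  have hn : ‖a‖ * ‖b‖ = 1 := by rw [← norm_mul, hab, norm_one]
  rcases lt_trichotomy ‖a‖ 1 with h | h | h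
  · exact ⟨a, h, hra⟩
  · exfalso
    have hb' : b = star a := by
      have h1 : a * star a = 1 := by
        have := Complex.mul_conj a
        rw [Complex.normSq_eq_norm_sq, h] at this
        simpa using this
      have ha0 : a ≠ 0 := left_ne_zero_of_mul_eq_one hab
      exact mul_left_cancel₀ ha0 (hab.trans h1.symm)
    apply hu
    have := congrArg Complex.im hsum
    rw [hb'] at this
    simpa using this
  · refine ⟨b, ?_, hrb⟩
    by_contra hc
    nlinarith [not_lt.1 hc]

/-- With `ζ` the small root of `ζ² + (z/v) ζ + 1 = 0`, the denominator `1 - 2ζ cos θ + ζ²` is `ζ/v`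
times `x - z` at `x = -2v cos θ`. The transform therefore equals `ζ / v`, and the claim is the
equation for `ζ`. -/
theorem stieltjes_semicircleMeasure_quadratic (hv : 0 < v) {z : ℂ} (hz : z.im ≠ 0) :
    1 + z * stieltjes (semicircleMeasure v) z
      + (v : ℂ) ^ 2 * stieltjes (semicircleMeasure v) z ^ 2 = 0 := by
  have hv' : (v : ℂ) ≠ 0 := by exact_mod_cast hv.ne'
  have hu : (z / v).im ≠ 0 := by
    rw [Complex.div_ofReal_im]
    exact div_ne_zero hz hv.ne'
  obtain ⟨ζ, hζ, hroot⟩ := exists_root_norm_lt_one hu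
  have hζ0 : ζ ≠ 0 := by
    rintro rfl
    simp at hroot
  have hpi : (Real.pi : ℂ) ≠ 0 := by exact_mod_cast Real.pi_ne_zero
  have hw : stieltjes (semicircleMeasure v) z = ζ / v := by
    rw [stieltjes_eq, integral_semicircleMeasure hv (continuous_one_div_ofReal_sub hz)]
    have e : ∀ θ : ℝ, Real.sin θ ^ 2 • (1 / (((-(2 * v * Real.cos θ) : ℝ) : ℂ) - z))
        = (ζ / v) * ((Real.sin θ : ℂ) ^ 2 / (1 - 2 * ζ * Real.cos θ + ζ ^ 2)) := by
      intro θ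
      have h1 := ofReal_sub_ne_zero (-(2 * v * Real.cos θ)) hz
      have h2 : 1 - 2 * ζ * Real.cos θ + ζ ^ 2
          = (ζ / v) * (((-(2 * v * Real.cos θ) : ℝ) : ℂ) - z) := by
        push_cast
        field_simp
        field_simp at hroot
        linear_combination hroot
      rw [h2, Complex.real_smul]
      push_cast at h1 ⊢
      field_simp
    simp_rw [e]
    rw [intervalIntegral.integral_const_mul, integral_sin_sq_div hζ, Complex.real_smul]
    push_cast
    field_simp
  rw [hw]
  field_simp
  field_simp at hroot
  linear_combination hroot

end Semicircle

/-! ### Bounds for Stieltjes transforms and stability of the quadratic equation -/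

theorem integrable_one_div_ofReal_sub (ν : Measure ℝ) [IsFiniteMeasure ν] {z : ℂ}
    (hz : z.im ≠ 0) : Integrable (fun x : ℝ => 1 / ((x : ℂ) - z)) ν :=
  Integrable.of_bound (continuous_one_div_ofReal_sub hz).aestronglyMeasurable _
    (Eventually.of_forall fun x => norm_one_div_ofReal_sub_le x hz)

theorem norm_stieltjes_le (ν : Measure ℝ) [IsProbabilityMeasure ν] {z : ℂ} (hz : z.im ≠ 0) :
    ‖stieltjes ν z‖ ≤ 1 / |z.im| := by
  rw [stieltjes_eq]
  simpa using norm_integral_le_of_norm_le_const (μ := ν)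
    (Eventually.of_forall fun x => norm_one_div_ofReal_sub_le x hz)

/-- The integrand is `(Im z)² / |x - z|²`, positive everywhere, so its integral against a
probability measure is positive. -/
theorem im_stieltjes_mul_im_pos (ν : Measure ℝ) [IsProbabilityMeasure ν] {z : ℂ}
    (hz : z.im ≠ 0) : 0 < (stieltjes ν z).im * z.im := by
  have hint := integrable_one_div_ofReal_sub ν hz
  have e : (stieltjes ν z).im * z.im = ∫ x : ℝ, (1 / ((x : ℂ) - z)).im * z.im ∂ν := by
    rw [stieltjes_eq, integral_mul_const]
    congr 1
    exact (integral_im hint).symm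
  have hpos : ∀ x : ℝ, 0 < (1 / ((x : ℂ) - z)).im * z.im := by
    intro x
    have h1 : (1 / ((x : ℂ) - z)).im * z.im = z.im ^ 2 / Complex.normSq ((x : ℂ) - z) := by
      rw [one_div, Complex.inv_im]
      simp
      ring
    rw [h1]
    exact div_pos (by positivity) (Complex.normSq_pos.2 (ofReal_sub_ne_zero x hz))
  rw [e, integral_pos_iff_support_of_nonneg (fun x => (hpos x).le) (hint.im.mul_const _)]
  have : Function.support (fun x : ℝ => (1 / ((x : ℂ) - z)).im * z.im) = Set.univ :=
    Set.eq_univ_of_forall fun x => (hpos x).ne'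
  rw [this]
  simp

/-- Stability of the quadratic equation of the semicircle law. -/
theorem norm_sub_mul_abs_im_le {v : ℝ} {z w g : ℂ} (hw : 1 + z * w + (v : ℂ) ^ 2 * w ^ 2 = 0)
    (hwz : 0 ≤ w.im * z.im) (hgz : 0 ≤ g.im * z.im) :
    ‖g - w‖ * |z.im| ≤ ‖1 + z * g + (v : ℂ) ^ 2 * g ^ 2‖ := by
  have e : 1 + z * g + (v : ℂ) ^ 2 * g ^ 2 = (g - w) * (z + (v : ℂ) ^ 2 * (g + w)) := by
    linear_combination hw
  rw [e, norm_mul]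
  refine mul_le_mul_of_nonneg_left ?_ (norm_nonneg _)
  refine le_trans ?_ (Complex.abs_im_le_norm _)
  have him : (z + (v : ℂ) ^ 2 * (g + w)).im = z.im + v ^ 2 * (g.im + w.im) := by
    rw [← Complex.ofReal_pow, Complex.add_im, Complex.im_ofReal_mul, Complex.add_im]
  rw [him]
  have hm : z.im ^ 2 ≤ (z.im + v ^ 2 * (g.im + w.im)) * z.im := by
    nlinarith [mul_nonneg (sq_nonneg v) hgz, mul_nonneg (sq_nonneg v) hwz]
  have h2 : |z.im| * |z.im| ≤ |z.im + v ^ 2 * (g.im + w.im)| * |z.im| := by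
    rw [← abs_mul, ← abs_mul, ← sq, abs_of_nonneg (sq_nonneg z.im)]
    exact hm.trans (le_abs_self _)
  by_cases h0 : z.im = 0
  · rw [h0, abs_zero]
    exact abs_nonneg _
  · exact le_of_mul_le_mul_right h2 (abs_pos.2 h0)

theorem eq_one_div_iff_quadratic {v : ℝ} {z u : ℂ} (hu : u ≠ 0) :
    u = 1 / (-z - (v : ℂ) ^ 2 * u) ↔ 1 + z * u + (v : ℂ) ^ 2 * u ^ 2 = 0 := by
  constructor
  · intro h
    -- A zero denominator would give `u = 0`, since `1 / 0 = 0`.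
    have hd : -z - (v : ℂ) ^ 2 * u ≠ 0 := by
      intro hd
      rw [hd, div_zero] at h
      exact hu h
    rw [eq_div_iff hd] at h
    linear_combination -h
  · intro h
    exact eq_one_div_of_mul_eq_one_left (by linear_combination -h)

/-! ### Spectral form of the resolvent of a real symmetric matrix -/

section Resolvent

variable {n : ℕ} {A B : Matrix (Fin n) (Fin n) ℝ} {z : ℂ}

open Matrix

/-- The matrix of eigenvectors of a real symmetric matrix, with complex entries. -/
noncomputable def complexEigenvectors (hA : A.IsHermitian) : Matrix (Fin n) (Fin n) ℂ :=
  (hA.eigenvectorUnitary : Matrix (Fin n) (Fin n) ℝ).map Complex.ofRealHom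

theorem eigenvectorUnitary_mul_transpose (hA : A.IsHermitian) :
    (hA.eigenvectorUnitary : Matrix (Fin n) (Fin n) ℝ)
      * (hA.eigenvectorUnitary : Matrix (Fin n) (Fin n) ℝ)ᵀ = 1 := by
  have h := Unitary.coe_mul_star_self hA.eigenvectorUnitary
  rwa [Unitary.coe_star, star_eq_conjTranspose, conjTranspose_eq_transpose_of_trivial] at h

theorem complexEigenvectors_mul_transpose (hA : A.IsHermitian) :
    complexEigenvectors hA * (complexEigenvectors hA)ᵀ = 1 := by
  rw [complexEigenvectors, ← transpose_map, ← Matrix.map_mul, eigenvectorUnitary_mul_transpose]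
  simp

theorem transpose_mul_complexEigenvectors (hA : A.IsHermitian) :
    (complexEigenvectors hA)ᵀ * complexEigenvectors hA = 1 :=
  mul_eq_one_comm.1 (complexEigenvectors_mul_transpose hA)

theorem map_ofReal_eq (hA : A.IsHermitian) :
    A.map (fun x : ℝ => (x : ℂ)) = complexEigenvectors hA
      * diagonal (fun i => (hA.eigenvalues i : ℂ)) * (complexEigenvectors hA)ᵀ := by
  have h := hA.spectral_theorem
  rw [Unitary.conjStarAlgAut_apply, star_eq_conjTranspose,
    conjTranspose_eq_transpose_of_trivial] at h
  have h2 := congrArg (fun M : Matrix (Fin n) (Fin n) ℝ => M.map Complex.ofRealHom) h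
  simp only [Matrix.map_mul] at h2
  rw [complexEigenvectors, ← transpose_map]
  refine h2.trans ?_
  congr 2
  rw [diagonal_map (by simp)]
  rfl

theorem map_ofReal_sub_eq (hA : A.IsHermitian) (z : ℂ) :
    A.map (fun x : ℝ => (x : ℂ)) - z • (1 : Matrix (Fin n) (Fin n) ℂ) = complexEigenvectors hA
      * diagonal (fun i => (hA.eigenvalues i : ℂ) - z) * (complexEigenvectors hA)ᵀ := by
  have hd : diagonal (fun i => (hA.eigenvalues i : ℂ) - z)
      = diagonal (fun i => (hA.eigenvalues i : ℂ)) - z • (1 : Matrix (Fin n) (Fin n) ℂ) := by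
    rw [← diagonal_one, ← diagonal_smul, diagonal_sub]
    congr 1
    funext i
    simp
  rw [hd, map_ofReal_eq hA, Matrix.mul_sub, Matrix.sub_mul, Matrix.mul_smul, Matrix.mul_one,
    Matrix.smul_mul, complexEigenvectors_mul_transpose]

theorem resolvent_eq (hA : A.IsHermitian) (hz : z.im ≠ 0) :
    resolvent A z = complexEigenvectors hA
      * diagonal (fun i => 1 / ((hA.eigenvalues i : ℂ) - z)) * (complexEigenvectors hA)ᵀ := by
  rw [resolvent]
  refine inv_eq_right_inv ?_
  rw [map_ofReal_sub_eq hA]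
  calc _ = complexEigenvectors hA * (diagonal (fun i => (hA.eigenvalues i : ℂ) - z)
        * ((complexEigenvectors hA)ᵀ * complexEigenvectors hA)
        * diagonal (fun i => 1 / ((hA.eigenvalues i : ℂ) - z))) * (complexEigenvectors hA)ᵀ := by
        simp only [Matrix.mul_assoc]
    _ = 1 := by
      rw [transpose_mul_complexEigenvectors, Matrix.mul_one, diagonal_mul_diagonal]
      have : (fun i => ((hA.eigenvalues i : ℂ) - z) * (1 / ((hA.eigenvalues i : ℂ) - z)))
          = fun _ => 1 := by
        funext i
        exact mul_one_div_cancel (ofReal_sub_ne_zero _ hz)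
      rw [this, diagonal_one, Matrix.mul_one, complexEigenvectors_mul_transpose]

theorem isUnit_map_ofReal_sub (hA : A.IsHermitian) (hz : z.im ≠ 0) :
    IsUnit (A.map (fun x : ℝ => (x : ℂ)) - z • (1 : Matrix (Fin n) (Fin n) ℂ)) := by
  rw [map_ofReal_sub_eq hA]
  refine ((IsUnit.of_mul_eq_one _ (complexEigenvectors_mul_transpose hA)).mul ?_).mul
    (IsUnit.of_mul_eq_one _ (transpose_mul_complexEigenvectors hA))
  rw [isUnit_iff_isUnit_det, det_diagonal, isUnit_iff_ne_zero, Finset.prod_ne_zero_iff]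
  exact fun i _ => ofReal_sub_ne_zero _ hz

theorem mul_resolvent (hA : A.IsHermitian) (hz : z.im ≠ 0) :
    A.map (fun x : ℝ => (x : ℂ)) * resolvent A z = 1 + z • resolvent A z := by
  have h := mul_nonsing_inv _ ((isUnit_iff_isUnit_det _).1 (isUnit_map_ofReal_sub hA hz))
  rw [Matrix.sub_mul, Matrix.smul_mul, Matrix.one_mul] at h
  exact sub_eq_iff_eq_add.1 h

theorem resolvent_sub_resolvent (hA : A.IsHermitian) (hB : B.IsHermitian) (hz : z.im ≠ 0) :
    resolvent A z - resolvent B z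
      = -(resolvent B z * (A - B).map (fun x : ℝ => (x : ℂ)) * resolvent A z) := by
  have h1 := mul_nonsing_inv _ ((isUnit_iff_isUnit_det _).1 (isUnit_map_ofReal_sub hA hz))
  have h2 := nonsing_inv_mul _ ((isUnit_iff_isUnit_det _).1 (isUnit_map_ofReal_sub hB hz))
  have e : (A - B).map (fun x : ℝ => (x : ℂ))
      = (A.map (fun x : ℝ => (x : ℂ)) - z • (1 : Matrix (Fin n) (Fin n) ℂ))
        - (B.map (fun x : ℝ => (x : ℂ)) - z • (1 : Matrix (Fin n) (Fin n) ℂ)) := by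
    ext i j
    simp
  rw [e, Matrix.mul_sub, Matrix.sub_mul, Matrix.mul_assoc]
  change _ = -(_ * (_ * (_)⁻¹) - (_)⁻¹ * _ * _)
  rw [h1, h2, Matrix.mul_one, Matrix.one_mul, neg_sub]

/-- The eigenvector matrix is real, so the diagonalization reads `U D Uᵀ` with a transpose and is
symmetric, although the resolvent is not Hermitian. -/
theorem resolvent_symm (hA : A.IsHermitian) (hz : z.im ≠ 0) (i j : Fin n) :
    resolvent A z i j = resolvent A z j i := by
  have : (resolvent A z)ᵀ = resolvent A z := by
    rw [resolvent_eq hA hz, transpose_mul, transpose_mul, transpose_transpose, diagonal_transpose,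
      Matrix.mul_assoc]
  rw [← this, transpose_apply, this]

theorem resolventTrace_eq (hA : A.IsHermitian) (hz : z.im ≠ 0) :
    resolventTrace A z = (n : ℂ)⁻¹ * ∑ i, 1 / ((hA.eigenvalues i : ℂ) - z) := by
  rw [resolventTrace, resolvent_eq hA hz, trace_mul_comm, ← Matrix.mul_assoc,
    transpose_mul_complexEigenvectors, Matrix.one_mul, trace_diagonal]

theorem isProbabilityMeasure_spectralMeasure (hA : A.IsHermitian) (hn : n ≠ 0) :
    IsProbabilityMeasure (spectralMeasure hA) := by
  refine ⟨?_⟩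
  simp only [spectralMeasure, Measure.smul_apply, Measure.finsetSum_apply, measure_univ,
    Finset.sum_const, Finset.card_univ, Fintype.card_fin, smul_eq_mul, nsmul_eq_mul, mul_one]
  exact ENNReal.inv_mul_cancel (by exact_mod_cast hn) (by simp)

theorem integral_spectralMeasure (hA : A.IsHermitian) {E : Type*} [NormedAddCommGroup E]
    [NormedSpace ℝ E] [CompleteSpace E] (f : ℝ → E) :
    ∫ x, f x ∂(spectralMeasure hA) = (n : ℝ)⁻¹ • ∑ i, f (hA.eigenvalues i) := by
  rw [spectralMeasure, integral_smul_measure, integral_finsetSum_measure]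
  · simp
  · intro i _
    exact integrable_dirac (by simp)

theorem stieltjes_spectralMeasure (hA : A.IsHermitian) (hz : z.im ≠ 0) :
    stieltjes (spectralMeasure hA) z = resolventTrace A z := by
  rw [stieltjes_eq, integral_spectralMeasure, resolventTrace_eq hA hz, Complex.real_smul]
  simp

/-- The sum is the diagonal entry of `G Gᴴ`, that is `∑ |D_m|² U_im²`, and the rows of `U` are unit
vectors. The bound does not grow with `n`; this is what makes off-diagonal resolvent entries
negligible on average. -/
theorem sum_norm_sq_resolvent_le (hA : A.IsHermitian) (hz : z.im ≠ 0) (i : Fin n) :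
    ∑ j, ‖resolvent A z i j‖ ^ 2 ≤ (1 / |z.im|) ^ 2 := by
  set U := complexEigenvectors hA with hU
  set D : Fin n → ℂ := fun i => 1 / ((hA.eigenvalues i : ℂ) - z) with hD
  have hUreal : Uᴴ = Uᵀ := by
    ext i j
    simp [hU, complexEigenvectors]
  have hUreal' : Uᵀᴴ = U := by
    rw [← hUreal, conjTranspose_conjTranspose]
  have hGG : resolvent A z * (resolvent A z)ᴴ = U * diagonal (fun i => D i * star (D i)) * Uᵀ := by
    rw [resolvent_eq hA hz, conjTranspose_mul, conjTranspose_mul, ← hU, hUreal, hUreal',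
      diagonal_conjTranspose, ← hD]
    calc _ = U * (diagonal D * (Uᵀ * U) * diagonal (star D)) * Uᵀ := by
          simp only [Matrix.mul_assoc]
      _ = _ := by
        rw [hU, transpose_mul_complexEigenvectors, Matrix.mul_one, diagonal_mul_diagonal]
        rfl
  have h1 : ((∑ j, ‖resolvent A z i j‖ ^ 2 : ℝ) : ℂ)
      = ((∑ m, ‖D m‖ ^ 2 * (hA.eigenvectorUnitary : Matrix (Fin n) (Fin n) ℝ) i m ^ 2 : ℝ) : ℂ) := by
    have h2 := congrArg (fun M : Matrix (Fin n) (Fin n) ℂ => M i i) hGG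
    rw [Matrix.mul_apply, Matrix.mul_apply] at h2
    simp only [conjTranspose_apply, mul_diagonal, transpose_apply] at h2
    push_cast
    refine Eq.trans ?_ (h2.trans ?_)
    · refine Finset.sum_congr rfl fun j _ => ?_
      exact (Complex.mul_conj' _).symm
    · refine Finset.sum_congr rfl fun m _ => ?_
      have : U i m = ((hA.eigenvectorUnitary : Matrix (Fin n) (Fin n) ℝ) i m : ℂ) := rfl
      rw [this]
      have h3 : D m * star (D m) = (‖D m‖ : ℂ) ^ 2 := Complex.mul_conj' _
      rw [h3]
      ring
  rw [Complex.ofReal_inj] at h1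
  rw [h1]
  have h4 : ∑ m, (hA.eigenvectorUnitary : Matrix (Fin n) (Fin n) ℝ) i m ^ 2 = 1 := by
    have h5 := congrArg (fun M : Matrix (Fin n) (Fin n) ℝ => M i i)
      (eigenvectorUnitary_mul_transpose hA)
    simp only [Matrix.mul_apply, transpose_apply, one_apply_eq] at h5
    rw [← h5]
    exact Finset.sum_congr rfl fun m _ => sq _
  calc _ ≤ ∑ m, (1 / |z.im|) ^ 2 * (hA.eigenvectorUnitary : Matrix (Fin n) (Fin n) ℝ) i m ^ 2 := by
        refine Finset.sum_le_sum fun m _ => mul_le_mul_of_nonneg_right ?_ (sq_nonneg _)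
        exact pow_le_pow_left₀ (norm_nonneg _) (norm_one_div_ofReal_sub_le _ hz) 2
    _ = _ := by rw [← Finset.mul_sum, h4, mul_one]

theorem norm_resolvent_apply_le (hA : A.IsHermitian) (hz : z.im ≠ 0) (i j : Fin n) :
    ‖resolvent A z i j‖ ≤ 1 / |z.im| := by
  have h1 := sum_norm_sq_resolvent_le hA hz i
  have h2 : ‖resolvent A z i j‖ ^ 2 ≤ ∑ j, ‖resolvent A z i j‖ ^ 2 :=
    Finset.single_le_sum (f := fun j => ‖resolvent A z i j‖ ^ 2) (fun _ _ => sq_nonneg _)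
      (Finset.mem_univ j)
  exact le_of_sq_le_sq (h2.trans h1) (by positivity)

theorem norm_resolventTrace_le (hA : A.IsHermitian) (hz : z.im ≠ 0) :
    ‖resolventTrace A z‖ ≤ 1 / |z.im| := by
  by_cases hn : n = 0
  · subst hn
    simp [resolventTrace]
  · have := isProbabilityMeasure_spectralMeasure hA hn
    rw [← stieltjes_spectralMeasure hA hz]
    exact norm_stieltjes_le _ hz

theorem eigenvalueCount_eq (hA : A.IsHermitian) (t : ℝ) :
    eigenvalueCount hA t = (spectralMeasure hA).real (Set.Iic t) := by
  rw [← integral_indicator_one measurableSet_Iic, integral_spectralMeasure, eigenvalueCount,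
    smul_eq_mul, Finset.card_filter]
  push_cast
  congr 1

end Resolvent

/-! ### Effect of removing one matrix entry -/

section Perturbation

variable {n : ℕ} {z : ℂ}

open Matrix

/-- The unordered pair `{i, j}` as an index of the upper triangle. -/
def upperPair (i j : Fin n) : UpperPair n := ⟨(min i j, max i j), min_le_max⟩

theorem upperPair_comm (i j : Fin n) : upperPair i j = upperPair j i := by
  simp [upperPair, min_comm, max_comm]

theorem upperPair_eq_iff {i j k l : Fin n} :
    upperPair k l = upperPair i j ↔ (k = i ∧ l = j) ∨ (k = j ∧ l = i) := by
  simp only [upperPair, Subtype.mk.injEq, Prod.mk.injEq]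
  constructor
  · rintro ⟨h1, h2⟩
    rcases le_total k l with a | a <;> rcases le_total i j with b | b <;> simp_all
  · rintro (⟨rfl, rfl⟩ | ⟨rfl, rfl⟩)
    · exact ⟨rfl, rfl⟩
    · exact ⟨min_comm _ _, max_comm _ _⟩

/-- The symmetric matrix with given upper triangle. -/
def symMatrix (x : UpperPair n → ℝ) : Matrix (Fin n) (Fin n) ℝ :=
  Matrix.of fun i j => x (upperPair i j)

theorem symMatrix_apply (x : UpperPair n → ℝ) (i j : Fin n) :
    symMatrix x i j = x (upperPair i j) := rfl

theorem symMatrix_isHermitian (x : UpperPair n → ℝ) : (symMatrix x).IsHermitian := by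
  ext i j
  simp [symMatrix_apply, upperPair_comm i j]

/-- Continuity in the entries supplies the measurability of all random quantities built from the
resolvent. -/
theorem continuous_resolvent_symMatrix (hz : z.im ≠ 0) :
    Continuous fun x : UpperPair n → ℝ => resolvent (symMatrix x) z := by
  have h1 : Continuous fun x : UpperPair n → ℝ =>
      (symMatrix x).map (fun y : ℝ => (y : ℂ)) - z • (1 : Matrix (Fin n) (Fin n) ℂ) := by
    refine Continuous.sub (continuous_matrix fun i j => ?_) continuous_const
    simp only [Matrix.map_apply, symMatrix_apply]
    fun_prop
  simp only [resolvent, Matrix.inv_def, Ring.inverse_eq_inv]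
  refine (h1.matrix_det.inv₀ fun x => ?_).smul h1.matrix_adjugate
  exact ((isUnit_iff_isUnit_det _).1 (isUnit_map_ofReal_sub (symMatrix_isHermitian x) hz)).ne_zero

theorem continuous_resolvent_symMatrix_apply (hz : z.im ≠ 0) (i j : Fin n) :
    Continuous fun x : UpperPair n → ℝ => resolvent (symMatrix x) z i j :=
  (continuous_resolvent_symMatrix hz).matrix_elem i j

/-- The resolvent expanded around the matrix with the entries `(i, j)` and `(j, i)` removed. -/
theorem resolvent_symMatrix_update (x : UpperPair n → ℝ) (hz : z.im ≠ 0) {i j : Fin n}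
    (hij : i ≠ j) (a b : Fin n) :
    resolvent (symMatrix x) z a b
      = resolvent (symMatrix (Function.update x (upperPair i j) 0)) z a b
        - (x (upperPair i j) : ℂ)
          * (resolvent (symMatrix (Function.update x (upperPair i j) 0)) z a i
              * resolvent (symMatrix x) z j b
            + resolvent (symMatrix (Function.update x (upperPair i j) 0)) z a j
              * resolvent (symMatrix x) z i b) := by
  set y := Function.update x (upperPair i j) 0 with hy
  have h := congrArg (fun M : Matrix (Fin n) (Fin n) ℂ => M a b)
    (resolvent_sub_resolvent (symMatrix_isHermitian x) (symMatrix_isHermitian y) hz)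
  have hd : (symMatrix x - symMatrix y).map (fun t : ℝ => (t : ℂ))
      = (x (upperPair i j) : ℂ) • (Matrix.single i j 1 + Matrix.single j i 1) := by
    ext k l
    simp only [Matrix.map_apply, Matrix.sub_apply, symMatrix_apply, hy, Function.update_apply,
      upperPair_eq_iff, Matrix.smul_apply, Matrix.add_apply, Matrix.single_apply, smul_eq_mul]
    by_cases h1 : k = i ∧ l = j
    · obtain ⟨rfl, rfl⟩ := h1
      simp [hij, hij.symm]
    · by_cases h2 : k = j ∧ l = i
      · obtain ⟨rfl, rfl⟩ := h2
        simp [hij, hij.symm, upperPair_comm]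
      · have h3 : ¬ (i = k ∧ j = l) := fun h => h1 ⟨h.1.symm, h.2.symm⟩
        have h4 : ¬ (j = k ∧ i = l) := fun h => h2 ⟨h.1.symm, h.2.symm⟩
        simp [h1, h2, h3, h4]
  rw [hd] at h
  have hs : ∀ k l : Fin n, (resolvent (symMatrix y) z * Matrix.single k l (1 : ℂ)
      * resolvent (symMatrix x) z) a b
        = resolvent (symMatrix y) z a k * resolvent (symMatrix x) z l b := by
    intro k l
    rw [Matrix.mul_assoc, Matrix.mul_apply, Finset.sum_eq_single k]
    · simp
    · intro m _ hm
      rw [Matrix.single_mul_apply_of_ne _ _ _ _ _ hm, mul_zero]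
    · simp
  simp only [Matrix.mul_smul, Matrix.smul_mul, Matrix.mul_add, Matrix.add_mul, Matrix.neg_apply,
    Matrix.sub_apply, Matrix.smul_apply, Matrix.add_apply, hs, smul_eq_mul] at h
  linear_combination h

theorem norm_resolvent_sub_update_le (x : UpperPair n → ℝ) (hz : z.im ≠ 0) {i j : Fin n}
    (hij : i ≠ j) (a b : Fin n) :
    ‖resolvent (symMatrix x) z a b
        - resolvent (symMatrix (Function.update x (upperPair i j) 0)) z a b‖
      ≤ 2 * (1 / |z.im|) ^ 2 * |x (upperPair i j)| := by
  set y := Function.update x (upperPair i j) 0 with hy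
  have bx := norm_resolvent_apply_le (symMatrix_isHermitian x) hz
  have by' := norm_resolvent_apply_le (symMatrix_isHermitian y) hz
  rw [resolvent_symMatrix_update x hz hij a b, ← hy, sub_sub_cancel_left, norm_neg, norm_mul,
    Complex.norm_real, Real.norm_eq_abs, mul_comm]
  refine mul_le_mul_of_nonneg_right ?_ (abs_nonneg _)
  refine (norm_add_le _ _).trans ?_
  rw [norm_mul, norm_mul]
  have h1 := mul_le_mul (by' a i) (bx j b) (norm_nonneg _) (by positivity)
  have h2 := mul_le_mul (by' a j) (bx i b) (norm_nonneg _) (by positivity)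
  linarith

/-- The first-order expansion is iterated once. Using the smaller of the trivial bound and the
Lipschitz bound for the inner difference gives a remainder that is quadratic for small entries but
only linear for large ones, so that moments of order `2 + ρ` suffice. -/
theorem norm_resolvent_remainder_le (x : UpperPair n → ℝ) (hz : z.im ≠ 0) {i j : Fin n}
    (hij : i ≠ j) (a b : Fin n) :
    ‖resolvent (symMatrix x) z a b
        - resolvent (symMatrix (Function.update x (upperPair i j) 0)) z a b
        + (x (upperPair i j) : ℂ)
          * (resolvent (symMatrix (Function.update x (upperPair i j) 0)) z a i
              * resolvent (symMatrix (Function.update x (upperPair i j) 0)) z j b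
            + resolvent (symMatrix (Function.update x (upperPair i j) 0)) z a j
              * resolvent (symMatrix (Function.update x (upperPair i j) 0)) z i b)‖
      ≤ 4 * ((1 / |z.im|) ^ 2 + (1 / |z.im|) ^ 3)
        * min |x (upperPair i j)| (|x (upperPair i j)| ^ 2) := by
  set y := Function.update x (upperPair i j) 0 with hy
  set c := 1 / |z.im| with hc
  have hc0 : 0 ≤ c := by positivity
  set h := x (upperPair i j) with hh
  have bx : ∀ i j, ‖resolvent (symMatrix x) z i j‖ ≤ c :=
    norm_resolvent_apply_le (symMatrix_isHermitian x) hz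
  have by' : ∀ i j, ‖resolvent (symMatrix y) z i j‖ ≤ c :=
    norm_resolvent_apply_le (symMatrix_isHermitian y) hz
  have bd : ∀ a b, ‖resolvent (symMatrix x) z a b - resolvent (symMatrix y) z a b‖
      ≤ min (2 * c) (2 * c ^ 2 * |h|) := by
    intro a b
    refine le_min ?_ (norm_resolvent_sub_update_le x hz hij a b)
    exact (norm_sub_le _ _).trans (by linarith [bx a b, by' a b])
  set m := min (2 * c) (2 * c ^ 2 * |h|) with hm
  have e : resolvent (symMatrix x) z a b - resolvent (symMatrix y) z a b
        + (h : ℂ) * (resolvent (symMatrix y) z a i * resolvent (symMatrix y) z j b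
            + resolvent (symMatrix y) z a j * resolvent (symMatrix y) z i b)
      = -(h : ℂ) * (resolvent (symMatrix y) z a i
            * (resolvent (symMatrix x) z j b - resolvent (symMatrix y) z j b)
          + resolvent (symMatrix y) z a j
            * (resolvent (symMatrix x) z i b - resolvent (symMatrix y) z i b)) := by
    linear_combination resolvent_symMatrix_update x hz hij a b
  rw [e, norm_mul, norm_neg, Complex.norm_real, Real.norm_eq_abs]
  have h1 : ‖resolvent (symMatrix y) z a i
            * (resolvent (symMatrix x) z j b - resolvent (symMatrix y) z j b)
          + resolvent (symMatrix y) z a j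
            * (resolvent (symMatrix x) z i b - resolvent (symMatrix y) z i b)‖ ≤ 2 * (c * m) := by
    refine (norm_add_le _ _).trans ?_
    rw [norm_mul, norm_mul]
    have h1 := mul_le_mul (by' a i) (bd j b) (norm_nonneg _) hc0
    have h2 := mul_le_mul (by' a j) (bd i b) (norm_nonneg _) hc0
    linarith
  refine (mul_le_mul_of_nonneg_left h1 (abs_nonneg h)).trans ?_
  have hah := abs_nonneg h
  rw [mul_min_of_nonneg |h| (|h| ^ 2) (show 0 ≤ 4 * (c ^ 2 + c ^ 3) by positivity)]
  refine le_min ?_ ?_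
  · have : c * m ≤ c * (2 * c) := mul_le_mul_of_nonneg_left (min_le_left _ _) hc0
    have h3 := mul_le_mul_of_nonneg_left this hah
    have h4 : 0 ≤ c ^ 3 * |h| := by positivity
    nlinarith
  · have : c * m ≤ c * (2 * c ^ 2 * |h|) := mul_le_mul_of_nonneg_left (min_le_right _ _) hc0
    have h3 := mul_le_mul_of_nonneg_left this hah
    have h4 : 0 ≤ c ^ 2 * |h| ^ 2 := by positivity
    nlinarith

/-- The diagonal sum of the perturbation is bounded through the square-summable rows of both
resolvents, not term by term. This keeps the factor `1 / n` of the normalized trace. -/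
theorem norm_resolventTrace_sub_update_le (x : UpperPair n → ℝ) (hz : z.im ≠ 0) {i j : Fin n}
    (hij : i ≠ j) :
    ‖resolventTrace (symMatrix x) z
        - resolventTrace (symMatrix (Function.update x (upperPair i j) 0)) z‖
      ≤ 2 * (1 / |z.im|) ^ 2 * |x (upperPair i j)| / n := by
  set y := Function.update x (upperPair i j) 0 with hy
  set c := 1 / |z.im| with hc
  have hx := symMatrix_isHermitian x
  have hy' := symMatrix_isHermitian y
  have hcs : ∀ k l : Fin n,
      ‖∑ a, resolvent (symMatrix y) z a k * resolvent (symMatrix x) z l a‖ ≤ c ^ 2 := by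
    intro k l
    have h1 := sum_norm_sq_resolvent_le hy' hz k
    have h2 := sum_norm_sq_resolvent_le hx hz l
    refine (norm_sum_le _ _).trans ?_
    calc _ ≤ ∑ a, (‖resolvent (symMatrix y) z k a‖ ^ 2
          + ‖resolvent (symMatrix x) z l a‖ ^ 2) / 2 := by
          refine Finset.sum_le_sum fun a _ => ?_
          rw [norm_mul, resolvent_symm hy' hz a k]
          nlinarith [sq_nonneg (‖resolvent (symMatrix y) z k a‖ - ‖resolvent (symMatrix x) z l a‖)]
      _ ≤ c ^ 2 := by
          rw [← Finset.sum_div, Finset.sum_add_distrib]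
          linarith
  have e : resolventTrace (symMatrix x) z - resolventTrace (symMatrix y) z
      = (n : ℂ)⁻¹ * (-(x (upperPair i j) : ℂ)
        * ((∑ a, resolvent (symMatrix y) z a i * resolvent (symMatrix x) z j a)
          + ∑ a, resolvent (symMatrix y) z a j * resolvent (symMatrix x) z i a)) := by
    rw [resolventTrace, resolventTrace, ← mul_sub]
    congr 1
    rw [Matrix.trace, Matrix.trace, ← Finset.sum_sub_distrib, ← Finset.sum_add_distrib,
      Finset.mul_sum]
    refine Finset.sum_congr rfl fun a _ => ?_
    simp only [Matrix.diag_apply]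
    linear_combination resolvent_symMatrix_update x hz hij a a
  rw [e, norm_mul, norm_inv, Complex.norm_natCast, norm_mul, norm_neg, Complex.norm_real,
    Real.norm_eq_abs, div_eq_inv_mul]
  refine mul_le_mul_of_nonneg_left ?_ (by positivity)
  rw [mul_comm]
  refine mul_le_mul_of_nonneg_right ?_ (abs_nonneg _)
  refine (norm_add_le _ _).trans ?_
  linarith [hcs i j, hcs j i]

/-- The defect of the normalized trace of the resolvent in the quadratic equation of the
semicircle law. -/
noncomputable def quadraticDefect (v : ℝ) (z : ℂ) (A : Matrix (Fin n) (Fin n) ℝ) : ℂ :=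
  1 + z * resolventTrace A z + (v : ℂ) ^ 2 * resolventTrace A z ^ 2

theorem continuous_quadraticDefect (v : ℝ) (hz : z.im ≠ 0) :
    Continuous fun x : UpperPair n → ℝ => quadraticDefect v z (symMatrix x) := by
  have h : Continuous fun x : UpperPair n → ℝ => resolventTrace (symMatrix x) z :=
    continuous_const.mul (continuous_resolvent_symMatrix hz).matrix_trace
  unfold quadraticDefect
  fun_prop

theorem norm_quadraticDefect_le (v : ℝ) {A : Matrix (Fin n) (Fin n) ℝ} (hA : A.IsHermitian)
    (hz : z.im ≠ 0) :
    ‖quadraticDefect v z A‖ ≤ 1 + ‖z‖ * (1 / |z.im|) + v ^ 2 * (1 / |z.im|) ^ 2 := by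
  have h := norm_resolventTrace_le hA hz
  unfold quadraticDefect
  refine (norm_add₃_le).trans ?_
  rw [norm_one, norm_mul, norm_mul, norm_pow, norm_pow, Complex.norm_real, Real.norm_eq_abs,
    sq_abs]
  gcongr

theorem norm_quadraticDefect_sub_update_le (v : ℝ) (x : UpperPair n → ℝ) (hz : z.im ≠ 0)
    {i j : Fin n} (hij : i ≠ j) :
    ‖quadraticDefect v z (symMatrix x)
        - quadraticDefect v z (symMatrix (Function.update x (upperPair i j) 0))‖
      ≤ (‖z‖ + 2 * v ^ 2 * (1 / |z.im|)) * (2 * (1 / |z.im|) ^ 2) * |x (upperPair i j)| / n := by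
  set y := Function.update x (upperPair i j) 0 with hy
  have h1 := norm_resolventTrace_le (symMatrix_isHermitian x) hz
  have h2 := norm_resolventTrace_le (symMatrix_isHermitian y) hz
  have h3 := norm_resolventTrace_sub_update_le x hz hij
  rw [← hy] at h3
  have e : quadraticDefect v z (symMatrix x) - quadraticDefect v z (symMatrix y)
      = (z + (v : ℂ) ^ 2 * (resolventTrace (symMatrix x) z + resolventTrace (symMatrix y) z))
        * (resolventTrace (symMatrix x) z - resolventTrace (symMatrix y) z) := by
    unfold quadraticDefect
    ring
  rw [e, norm_mul, mul_assoc _ (2 * _), mul_div_assoc]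
  refine mul_le_mul ?_ h3 (norm_nonneg _) (by positivity)
  refine (norm_add_le _ _).trans ?_
  rw [norm_mul, norm_pow, Complex.norm_real, Real.norm_eq_abs, sq_abs]
  have h4 := norm_add_le (resolventTrace (symMatrix x) z) (resolventTrace (symMatrix y) z)
  nlinarith [mul_le_mul_of_nonneg_left (h4.trans (add_le_add h1 h2)) (sq_nonneg v)]

/-- Taking the trace of `A G = 1 + z G` produces `1 + z g`; the double sum of `G_ii G_jj` is the
square of the trace. -/
theorem quadraticDefect_eq_sum (v : ℝ) (hn : n ≠ 0) {A : Matrix (Fin n) (Fin n) ℝ}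
    (hA : A.IsHermitian) (hz : z.im ≠ 0) :
    quadraticDefect v z A = (n : ℂ)⁻¹ * ∑ i, ∑ j, ((A i j : ℂ) * resolvent A z j i
      + ((v ^ 2 / n : ℝ) : ℂ) * (resolvent A z i i * resolvent A z j j)) := by
  have hn' : (n : ℂ) ≠ 0 := by exact_mod_cast hn
  have h1 : ∑ i, ∑ j, (A i j : ℂ) * resolvent A z j i = n + z * (resolvent A z).trace := by
    have h := congrArg Matrix.trace (mul_resolvent hA hz)
    rw [Matrix.trace_add, Matrix.trace_smul, Matrix.trace_one, Fintype.card_fin] at h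
    rw [← smul_eq_mul, ← h]
    rfl
  have h2 : ∑ i, ∑ j, ((v ^ 2 / n : ℝ) : ℂ) * (resolvent A z i i * resolvent A z j j)
      = ((v ^ 2 / n : ℝ) : ℂ) * (resolvent A z).trace ^ 2 := by
    simp_rw [← Finset.mul_sum]
    rw [← Finset.sum_mul, sq (resolvent A z).trace]
    rfl
  simp_rw [Finset.sum_add_distrib]
  rw [h1, h2, quadraticDefect, resolventTrace]
  push_cast
  field_simp

end Perturbation

/-! ### Second moment of the defect -/

/-- Here `h` is the entry and `s` its variance; `G, Q, R` stand for the resolvent entries `ji`,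
`ii`, `jj`, and the index 0 marks the matrix without the entry. The two subtracted terms are those
that will have mean zero. Replacing `h²` by `s` cancels `Q * R` to leading order and leaves `-s G²
Φ₀`. -/
theorem norm_expansion_remainder_le {h s c B r l : ℝ} {G Q R G₀ Q₀ R₀ Φ Φ₀ : ℂ} (hs : 0 ≤ s)
    (hG : ‖G‖ ≤ c) (hQ : ‖Q‖ ≤ c) (hR : ‖R‖ ≤ c) (hG₀ : ‖G₀‖ ≤ c) (hQ₀ : ‖Q₀‖ ≤ c)
    (hΦ₀ : ‖Φ₀‖ ≤ B) (dG : ‖G - G₀‖ ≤ 2 * c ^ 2 * |h|) (dQ : ‖Q - Q₀‖ ≤ 2 * c ^ 2 * |h|)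
    (dR : ‖R - R₀‖ ≤ 2 * c ^ 2 * |h|) (hr : ‖G - G₀ + h * (G₀ * G₀ + R₀ * Q₀)‖ ≤ r)
    (hl : ‖Φ - Φ₀‖ ≤ l) :
    ‖((h : ℂ) * G + (s : ℂ) * (Q * R)) * Φ - (h : ℂ) * (G₀ * Φ₀)
        - ((s - h ^ 2 : ℝ) : ℂ) * ((G₀ * G₀ + R₀ * Q₀) * Φ₀)‖
      ≤ |h| * r * B + |h| * (c * l) + s * (c ^ 2 * l + 8 * c ^ 3 * B * |h| + B * ‖G‖ ^ 2) := by
  have hc : 0 ≤ c := (norm_nonneg _).trans hG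
  have hB : 0 ≤ B := (norm_nonneg _).trans hΦ₀
  have hh := abs_nonneg h
  have e : ((h : ℂ) * G + (s : ℂ) * (Q * R)) * Φ - (h : ℂ) * (G₀ * Φ₀)
        - ((s - h ^ 2 : ℝ) : ℂ) * ((G₀ * G₀ + R₀ * Q₀) * Φ₀)
      = (h : ℂ) * (G - G₀ + h * (G₀ * G₀ + R₀ * Q₀)) * Φ₀ + (h : ℂ) * (G * (Φ - Φ₀))
        + (s : ℂ) * (Q * R * (Φ - Φ₀) + ((Q - Q₀) * R + Q₀ * (R - R₀)
          + ((G - G₀) * G + G₀ * (G - G₀))) * Φ₀ - Φ₀ * G ^ 2) := by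
    push_cast
    ring
  have n1 : ‖(h : ℂ) * (G - G₀ + h * (G₀ * G₀ + R₀ * Q₀)) * Φ₀‖ ≤ |h| * r * B := by
    rw [norm_mul, norm_mul, Complex.norm_real, Real.norm_eq_abs]
    have : 0 ≤ r := (norm_nonneg _).trans hr
    gcongr
  have n2 : ‖(h : ℂ) * (G * (Φ - Φ₀))‖ ≤ |h| * (c * l) := by
    rw [norm_mul, norm_mul, Complex.norm_real, Real.norm_eq_abs]
    gcongr
  have n3 : ‖Q * R * (Φ - Φ₀)‖ ≤ c ^ 2 * l := by
    rw [norm_mul, norm_mul, sq]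
    gcongr
  have d := mul_nonneg (mul_nonneg zero_le_two (sq_nonneg c)) hh
  have n4 : ‖(Q - Q₀) * R + Q₀ * (R - R₀) + ((G - G₀) * G + G₀ * (G - G₀))‖
      ≤ 8 * c ^ 3 * |h| := by
    have a1 : ‖(Q - Q₀) * R‖ ≤ 2 * c ^ 2 * |h| * c := by
      rw [norm_mul]; exact mul_le_mul dQ hR (norm_nonneg _) d
    have a2 : ‖Q₀ * (R - R₀)‖ ≤ c * (2 * c ^ 2 * |h|) := by
      rw [norm_mul]; exact mul_le_mul hQ₀ dR (norm_nonneg _) hc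
    have a3 : ‖(G - G₀) * G‖ ≤ 2 * c ^ 2 * |h| * c := by
      rw [norm_mul]; exact mul_le_mul dG hG (norm_nonneg _) d
    have a4 : ‖G₀ * (G - G₀)‖ ≤ c * (2 * c ^ 2 * |h|) := by
      rw [norm_mul]; exact mul_le_mul hG₀ dG (norm_nonneg _) hc
    have t1 := norm_add_le ((Q - Q₀) * R + Q₀ * (R - R₀)) ((G - G₀) * G + G₀ * (G - G₀))
    have t2 := norm_add_le ((Q - Q₀) * R) (Q₀ * (R - R₀))
    have t3 := norm_add_le ((G - G₀) * G) (G₀ * (G - G₀))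
    have t4 : 8 * c ^ 3 * |h| = 2 * (2 * c ^ 2 * |h| * c) + 2 * (c * (2 * c ^ 2 * |h|)) := by ring
    linarith
  have n5 : ‖((Q - Q₀) * R + Q₀ * (R - R₀) + ((G - G₀) * G + G₀ * (G - G₀))) * Φ₀‖
      ≤ 8 * c ^ 3 * B * |h| := by
    rw [norm_mul]
    calc _ ≤ 8 * c ^ 3 * |h| * B := mul_le_mul n4 hΦ₀ (norm_nonneg _) (by positivity)
      _ = _ := by ring
  have n6 : ‖Φ₀ * G ^ 2‖ ≤ B * ‖G‖ ^ 2 := by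
    rw [norm_mul, norm_pow]
    gcongr
  rw [e]
  refine norm_add₃_le.trans (add_le_add (add_le_add n1 n2) ?_)
  rw [norm_mul, Complex.norm_real, Real.norm_eq_abs, abs_of_nonneg hs]
  refine mul_le_mul_of_nonneg_left ?_ hs
  exact (norm_sub_le _ _).trans (add_le_add ((norm_add_le _ _).trans (add_le_add n3 n5)) n6)

section Expectation

variable {Ω : Type*} [MeasurableSpace Ω] {P : Measure Ω} {n : ℕ}
  {x : Ω → UpperPair n → ℝ} {z : ℂ}

/-- The updated family is a function of the coordinates other than `e` alone, and disjoint blocks of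
an independent family are independent. -/
theorem indepFun_update (hm : ∀ e, Measurable fun ω => x ω e)
    (hx : iIndepFun (fun e ω => x ω e) P) (e : UpperPair n) :
    IndepFun (fun ω => x ω e) (fun ω => Function.update (x ω) e 0) P := by
  classical
  have h := hx.indepFun_finset {e} {e}ᶜ disjoint_compl_right hm
  have hφ : Measurable fun u : ({e} : Finset (UpperPair n)) → ℝ => u ⟨e, by simp⟩ :=
    measurable_pi_apply _
  have hψ : Measurable fun (u : (({e}ᶜ : Finset (UpperPair n))) → ℝ) (f : UpperPair n) =>
      if hf : f ∈ ({e}ᶜ : Finset (UpperPair n)) then u ⟨f, hf⟩ else 0 := by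
    refine measurable_pi_lambda _ fun f => ?_
    by_cases hf : f ∈ ({e}ᶜ : Finset (UpperPair n))
    · simp only [hf, dite_true]; exact measurable_pi_apply _
    · simp only [hf, dite_false]; exact measurable_const
  have h2 := h.comp hφ hψ
  have h3 : (fun ω => Function.update (x ω) e 0)
      = (fun (u : (({e}ᶜ : Finset (UpperPair n))) → ℝ) (f : UpperPair n) =>
        if hf : f ∈ ({e}ᶜ : Finset (UpperPair n)) then u ⟨f, hf⟩ else 0)
        ∘ fun ω (f : (({e}ᶜ : Finset (UpperPair n)))) => x ω f := by
    funext ω f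
    by_cases hf : f = e
    · subst hf; simp
    · simp [hf]
  rw [h3]
  exact h2

theorem integral_mul_update (hm : ∀ e, Measurable fun ω => x ω e)
    (hx : iIndepFun (fun e ω => x ω e) P) (e : UpperPair n) {φ : ℝ → ℝ} (hφ : Measurable φ)
    (h0 : ∫ ω, φ (x ω e) ∂P = 0) {F : (UpperPair n → ℝ) → ℂ} (hF : Measurable F) :
    ∫ ω, (φ (x ω e) : ℂ) * F (Function.update (x ω) e 0) ∂P = 0 := by
  have h := (indepFun_update hm hx e).comp (φ := fun t => (φ t : ℂ)) (ψ := F)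
    (by fun_prop) hF
  have hmx : Measurable fun ω => Function.update (x ω) e 0 := by
    refine measurable_pi_lambda _ fun f => ?_
    simp only [Function.update_apply]
    split_ifs
    · exact measurable_const
    · exact hm f
  have h2 := h.integral_fun_mul_eq_mul_integral
    (by have := hm e; exact (by fun_prop : Measurable _).aestronglyMeasurable)
    (hF.comp hmx).aestronglyMeasurable
  simp only [Function.comp] at h2
  rw [h2, integral_complex_ofReal, h0]
  simp

end Expectation

section Expectation

variable {Ω : Type*} [MeasurableSpace Ω] {P : Measure Ω} [IsProbabilityMeasure P] {n : ℕ}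
  {x : Ω → UpperPair n → ℝ} {z : ℂ}

theorem integrable_comp_of_bounded (hm : ∀ e, Measurable fun ω => x ω e)
    {F : (UpperPair n → ℝ) → ℂ} (hF : Measurable F) {C : ℝ} (hC : ∀ y, ‖F y‖ ≤ C) :
    Integrable (fun ω => F (x ω)) P :=
  Integrable.of_bound (hF.comp (measurable_pi_lambda _ hm)).aestronglyMeasurable C
    (Eventually.of_forall fun _ => hC _)

/-- Integrates the inequality `|X| ≤ X² / (2√s) + √s / 2`. -/
theorem integral_abs_le_sqrt {X : Ω → ℝ} (hX : MemLp X 2 P) {s : ℝ} (hs : 0 < s)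
    (h : ∫ ω, X ω ^ 2 ∂P ≤ s) : ∫ ω, |X ω| ∂P ≤ √s := by
  have hq := Real.sqrt_pos.2 hs
  have hq2 := Real.sq_sqrt hs.le
  calc ∫ ω, |X ω| ∂P ≤ ∫ ω, ((√s)⁻¹ / 2 * X ω ^ 2 + √s / 2) ∂P := by
        refine integral_mono (hX.integrable one_le_two).abs
          ((hX.integrable_sq.const_mul _).add (integrable_const _)) fun ω => ?_
        have e : (√s)⁻¹ / 2 * X ω ^ 2 + √s / 2 - |X ω| = (√s)⁻¹ / 2 * (|X ω| - √s) ^ 2 := by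
          rw [← sq_abs (X ω)]
          field_simp
          ring
        have : 0 ≤ (√s)⁻¹ / 2 * (|X ω| - √s) ^ 2 := by positivity
        simp only
        linarith
    _ = (√s)⁻¹ / 2 * ∫ ω, X ω ^ 2 ∂P + √s / 2 := by
        rw [integral_add (hX.integrable_sq.const_mul _) (integrable_const _), integral_const_mul]
        simp
    _ ≤ (√s)⁻¹ / 2 * s + √s / 2 := by gcongr
    _ = √s := by
        nth_rewrite 2 [← hq2]
        field_simp
        ring

/-- The contribution of the entry `(i, j)` to `𝔼 (quadraticDefect * Φ)`. -/
theorem norm_integral_entry_le_of_ne (hm : ∀ e, Measurable fun ω => x ω e)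
    (hx : iIndepFun (fun e ω => x ω e) P) (hL : ∀ e, MemLp (fun ω => x ω e) 2 P)
    (hz : z.im ≠ 0) {s m κ B l : ℝ} (hs : 0 ≤ s) {i j : Fin n} (hij : i ≠ j)
    (h1 : ∫ ω, x ω (upperPair i j) ∂P = 0) (h2 : ∫ ω, x ω (upperPair i j) ^ 2 ∂P = s)
    (h3 : ∫ ω, |x ω (upperPair i j)| * min |x ω (upperPair i j)| (|x ω (upperPair i j)| ^ 2) ∂P
      ≤ m) (hκ : ∫ ω, |x ω (upperPair i j)| ∂P ≤ κ)
    {Φ : (UpperPair n → ℝ) → ℂ} (hΦ : Measurable Φ) (hB : ∀ y, ‖Φ y‖ ≤ B) (hl : 0 ≤ l)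
    (hΦl : ∀ y, ‖Φ y - Φ (Function.update y (upperPair i j) 0)‖ ≤ l * |y (upperPair i j)|) :
    ‖∫ ω, ((x ω (upperPair i j) : ℂ) * resolvent (symMatrix (x ω)) z j i
        + (s : ℂ) * (resolvent (symMatrix (x ω)) z i i * resolvent (symMatrix (x ω)) z j j))
        * Φ (x ω) ∂P‖
      ≤ 4 * ((1 / |z.im|) ^ 2 + (1 / |z.im|) ^ 3) * B * m + (1 / |z.im|) * l * s
        + s * (((1 / |z.im|) ^ 2 * l + 8 * (1 / |z.im|) ^ 3 * B) * κ)
        + s * B * ∫ ω, ‖resolvent (symMatrix (x ω)) z j i‖ ^ 2 ∂P := by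
  set e := upperPair i j with he
  set c := 1 / |z.im| with hc
  have hc0 : 0 ≤ c := by positivity
  have hB0 : 0 ≤ B := (norm_nonneg _).trans (hB 0)
  let G : (UpperPair n → ℝ) → Fin n → Fin n → ℂ := fun y => resolvent (symMatrix y) z
  have hGm : ∀ a b, Measurable fun y => G y a b := fun a b =>
    (continuous_resolvent_symMatrix_apply hz a b).measurable
  have hGb : ∀ y a b, ‖G y a b‖ ≤ c := fun y =>
    norm_resolvent_apply_le (symMatrix_isHermitian y) hz
  let F₁ : (UpperPair n → ℝ) → ℂ := fun y => G y j i * Φ y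
  let F₂ : (UpperPair n → ℝ) → ℂ := fun y => (G y j i * G y j i + G y j j * G y i i) * Φ y
  have hF₁ : Measurable F₁ := (hGm j i).mul hΦ
  have hF₂ : Measurable F₂ := (((hGm j i).mul (hGm j i)).add ((hGm j j).mul (hGm i i))).mul hΦ
  have hxe : Integrable (fun ω => x ω e) P := (hL e).integrable one_le_two
  have hxe2 : Integrable (fun ω => x ω e ^ 2) P := (hL e).integrable_sq
  have hmx : Measurable fun ω => Function.update (x ω) e 0 := by
    refine measurable_pi_lambda _ fun f => ?_
    simp only [Function.update_apply]
    split_ifs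
    · exact measurable_const
    · exact hm f
  have hme := hm e
  have bF₁ : ∀ y, ‖F₁ y‖ ≤ c * B := fun y => by
    simp only [F₁, norm_mul]
    exact mul_le_mul (hGb y j i) (hB y) (norm_nonneg _) hc0
  have bF₂ : ∀ y, ‖F₂ y‖ ≤ (c * c + c * c) * B := fun y => by
    simp only [F₂, norm_mul]
    refine mul_le_mul ((norm_add_le _ _).trans ?_) (hB y) (norm_nonneg _) (by positivity)
    rw [norm_mul, norm_mul]
    exact add_le_add (mul_le_mul (hGb y j i) (hGb y j i) (norm_nonneg _) hc0)
      (mul_le_mul (hGb y j j) (hGb y i i) (norm_nonneg _) hc0)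
  -- The linear term vanishes because the entry is centred, and the term with `s - h²` because `s`
  -- is the exact variance. Both are independent of the reduced matrix.
  have z1 : ∫ ω, ((x ω e : ℝ) : ℂ) * F₁ (Function.update (x ω) e 0) ∂P = 0 :=
    integral_mul_update hm hx e (φ := fun t => t) measurable_id h1 hF₁
  have z2 : ∫ ω, ((s - x ω e ^ 2 : ℝ) : ℂ) * F₂ (Function.update (x ω) e 0) ∂P = 0 := by
    refine integral_mul_update hm hx e (φ := fun t => s - t ^ 2) (by fun_prop) ?_ hF₂
    rw [integral_sub (integrable_const _) hxe2, h2]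
    simp
  have i1 : Integrable (fun ω => ((x ω e : ℝ) : ℂ) * F₁ (Function.update (x ω) e 0)) P :=
    hxe.ofReal.mul_bdd (hF₁.comp hmx).aestronglyMeasurable (Eventually.of_forall fun ω => bF₁ _)
  have i2 : Integrable (fun ω => ((s - x ω e ^ 2 : ℝ) : ℂ)
      * F₂ (Function.update (x ω) e 0)) P :=
    ((integrable_const s).sub hxe2).ofReal.mul_bdd (hF₂.comp hmx).aestronglyMeasurable
      (Eventually.of_forall fun ω => bF₂ _)
  have i3 : Integrable (fun ω => ((x ω e : ℂ) * G (x ω) j i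
        + (s : ℂ) * (G (x ω) i i * G (x ω) j j)) * Φ (x ω)) P := by
    have hxm := measurable_pi_lambda x hm
    refine Integrable.mul_bdd (c := B) ?_ (hΦ.comp hxm).aestronglyMeasurable
      (Eventually.of_forall fun ω => hB _)
    refine (hxe.ofReal.mul_bdd (c := c) ((hGm j i).comp hxm).aestronglyMeasurable
      (Eventually.of_forall fun ω => hGb _ _ _)).add (Integrable.const_mul ?_ _)
    refine integrable_comp_of_bounded hm (F := fun y => G y i i * G y j j) (C := c * c)
      ((hGm i i).mul (hGm j j)) fun y => ?_
    rw [norm_mul]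
    exact mul_le_mul (hGb y i i) (hGb y j j) (norm_nonneg _) hc0
  have i4 : Integrable (fun ω => |x ω e| * min |x ω e| (|x ω e| ^ 2)) P := by
    refine hxe2.mono' (by fun_prop) (Eventually.of_forall fun ω => ?_)
    have hp : 0 ≤ min |x ω e| (|x ω e| ^ 2) := le_min (abs_nonneg _) (sq_nonneg _)
    rw [Real.norm_eq_abs, abs_of_nonneg (mul_nonneg (abs_nonneg _) hp)]
    calc _ ≤ |x ω e| * |x ω e| := mul_le_mul_of_nonneg_left (min_le_left _ _) (abs_nonneg _)
      _ = x ω e ^ 2 := by rw [abs_mul_abs_self, sq]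
  have i5 : Integrable (fun ω => ‖G (x ω) j i‖ ^ 2) P := by
    refine Integrable.of_bound (C := c ^ 2) ?_ (Eventually.of_forall fun ω => ?_)
    · exact (((hGm j i).comp (measurable_pi_lambda x hm)).norm.pow_const 2).aestronglyMeasurable
    · rw [norm_pow, norm_norm]
      exact pow_le_pow_left₀ (norm_nonneg _) (hGb _ _ _) 2
  have key : ∀ ω, ‖((x ω e : ℂ) * G (x ω) j i + (s : ℂ) * (G (x ω) i i * G (x ω) j j)) * Φ (x ω)
        - ((x ω e : ℝ) : ℂ) * F₁ (Function.update (x ω) e 0)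
        - ((s - x ω e ^ 2 : ℝ) : ℂ) * F₂ (Function.update (x ω) e 0)‖
      ≤ 4 * (c ^ 2 + c ^ 3) * B * (|x ω e| * min |x ω e| (|x ω e| ^ 2)) + c * l * x ω e ^ 2
        + s * (c ^ 2 * l + 8 * c ^ 3 * B) * |x ω e| + s * B * ‖G (x ω) j i‖ ^ 2 := by
    intro ω
    have hd := norm_resolvent_sub_update_le (x ω) hz hij
    have := norm_expansion_remainder_le hs (hGb (x ω) j i) (hGb (x ω) i i) (hGb (x ω) j j)
      (hGb (Function.update (x ω) e 0) j i) (hGb (Function.update (x ω) e 0) i i)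
      (hB (Function.update (x ω) e 0)) (hd j i) (hd i i) (hd j j)
      (norm_resolvent_remainder_le (x ω) hz hij j i) (hΦl (x ω))
    refine this.trans (le_of_eq ?_)
    rw [← sq_abs (x ω e)]
    ring
  have i31 : Integrable (fun ω => ((x ω e : ℂ) * G (x ω) j i
      + (s : ℂ) * (G (x ω) i i * G (x ω) j j)) * Φ (x ω)
        - ((x ω e : ℝ) : ℂ) * F₁ (Function.update (x ω) e 0)) P := i3.sub i1
  have j1 : Integrable (fun ω => 4 * (c ^ 2 + c ^ 3) * B * (|x ω e| * min |x ω e| (|x ω e| ^ 2))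
      + c * l * x ω e ^ 2) P := (i4.const_mul _).add (hxe2.const_mul _)
  have j2 : Integrable (fun ω => 4 * (c ^ 2 + c ^ 3) * B * (|x ω e| * min |x ω e| (|x ω e| ^ 2))
      + c * l * x ω e ^ 2 + s * (c ^ 2 * l + 8 * c ^ 3 * B) * |x ω e|) P :=
    j1.add (hxe.abs.const_mul _)
  have j3 : Integrable (fun ω => 4 * (c ^ 2 + c ^ 3) * B * (|x ω e| * min |x ω e| (|x ω e| ^ 2))
      + c * l * x ω e ^ 2 + s * (c ^ 2 * l + 8 * c ^ 3 * B) * |x ω e|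
      + s * B * ‖G (x ω) j i‖ ^ 2) P := j2.add (i5.const_mul _)
  -- Subtracting terms of mean zero is free, and the pointwise bound applies to the difference.
  have hsplit : ∫ ω, ((x ω e : ℂ) * G (x ω) j i + (s : ℂ) * (G (x ω) i i * G (x ω) j j))
        * Φ (x ω) ∂P
      = ∫ ω, (((x ω e : ℂ) * G (x ω) j i + (s : ℂ) * (G (x ω) i i * G (x ω) j j)) * Φ (x ω)
        - ((x ω e : ℝ) : ℂ) * F₁ (Function.update (x ω) e 0)
        - ((s - x ω e ^ 2 : ℝ) : ℂ) * F₂ (Function.update (x ω) e 0)) ∂P := by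
    rw [integral_sub i31 i2, integral_sub i3 i1, z1, z2, sub_zero, sub_zero]
  have hbound := norm_integral_le_of_norm_le j3 (Eventually.of_forall key)
  change ‖∫ ω, ((x ω e : ℂ) * G (x ω) j i + (s : ℂ) * (G (x ω) i i * G (x ω) j j))
        * Φ (x ω) ∂P‖ ≤ _
  rw [hsplit]
  refine hbound.trans ?_
  rw [integral_add j2 (i5.const_mul _), integral_add j1 (hxe.abs.const_mul _),
    integral_add (i4.const_mul _) (hxe2.const_mul _),
    integral_const_mul, integral_const_mul, integral_const_mul, integral_const_mul, h2,
    mul_assoc s]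
  gcongr

end Expectation

section Expectation

variable {Ω : Type*} [MeasurableSpace Ω] {P : Measure Ω} [IsProbabilityMeasure P] {n : ℕ}
  {x : Ω → UpperPair n → ℝ} {z : ℂ}

theorem integrable_entry (hm : ∀ e, Measurable fun ω => x ω e) (hL : ∀ e, MemLp (fun ω => x ω e) 2 P)
    (hz : z.im ≠ 0) (s : ℝ) {B : ℝ} (i j : Fin n)
    {Φ : (UpperPair n → ℝ) → ℂ} (hΦ : Measurable Φ) (hB : ∀ y, ‖Φ y‖ ≤ B) :
    Integrable (fun ω => ((x ω (upperPair i j) : ℂ) * resolvent (symMatrix (x ω)) z j i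
        + (s : ℂ) * (resolvent (symMatrix (x ω)) z i i * resolvent (symMatrix (x ω)) z j j))
        * Φ (x ω)) P := by
  have hGm : ∀ a b, Measurable fun y : UpperPair n → ℝ => resolvent (symMatrix y) z a b :=
    fun a b => (continuous_resolvent_symMatrix_apply hz a b).measurable
  have hGb : ∀ (y : UpperPair n → ℝ) a b, ‖resolvent (symMatrix y) z a b‖ ≤ 1 / |z.im| := fun y =>
    norm_resolvent_apply_le (symMatrix_isHermitian y) hz
  have hxm := measurable_pi_lambda x hm
  refine Integrable.mul_bdd (c := B) ?_ (hΦ.comp hxm).aestronglyMeasurable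
    (Eventually.of_forall fun ω => hB _)
  refine (((hL _).integrable one_le_two).ofReal.mul_bdd (c := 1 / |z.im|)
    ((hGm j i).comp hxm).aestronglyMeasurable
    (Eventually.of_forall fun ω => hGb _ _ _)).add (Integrable.const_mul ?_ _)
  refine integrable_comp_of_bounded hm (F := fun y => resolvent (symMatrix y) z i i
    * resolvent (symMatrix y) z j j) (C := 1 / |z.im| * (1 / |z.im|))
    ((hGm i i).mul (hGm j j)) fun y => ?_
  rw [norm_mul]
  exact mul_le_mul (hGb y i i) (hGb y j j) (norm_nonneg _) (by positivity)

/-- Used on the diagonal. There are only `n` such terms against the prefactor `n⁻¹`, so a bound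
without any cancellation is enough. -/
theorem norm_integral_entry_le (hL : ∀ e, MemLp (fun ω => x ω e) 2 P) (hz : z.im ≠ 0)
    {s κ B : ℝ} (hs : 0 ≤ s) (i j : Fin n) (hκ : ∫ ω, |x ω (upperPair i j)| ∂P ≤ κ)
    {Φ : (UpperPair n → ℝ) → ℂ} (hB : ∀ y, ‖Φ y‖ ≤ B) :
    ‖∫ ω, ((x ω (upperPair i j) : ℂ) * resolvent (symMatrix (x ω)) z j i
        + (s : ℂ) * (resolvent (symMatrix (x ω)) z i i * resolvent (symMatrix (x ω)) z j j))
        * Φ (x ω) ∂P‖ ≤ (1 / |z.im|) * B * κ + s * (1 / |z.im|) ^ 2 * B := by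
  set c := 1 / |z.im| with hc
  have hc0 : 0 ≤ c := by positivity
  have hB0 : 0 ≤ B := (norm_nonneg _).trans (hB 0)
  have hG : ∀ (y : UpperPair n → ℝ) a b, ‖resolvent (symMatrix y) z a b‖ ≤ c := fun y =>
    norm_resolvent_apply_le (symMatrix_isHermitian y) hz
  have hi := ((hL (upperPair i j)).integrable one_le_two).abs
  have h := norm_integral_le_of_norm_le
    (f := fun ω => ((x ω (upperPair i j) : ℂ) * resolvent (symMatrix (x ω)) z j i
        + (s : ℂ) * (resolvent (symMatrix (x ω)) z i i * resolvent (symMatrix (x ω)) z j j))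
        * Φ (x ω))
    ((hi.const_mul (c * B)).add (integrable_const (s * c ^ 2 * B)))
    (Eventually.of_forall fun ω => by
      rw [norm_mul]
      have h1 : ‖(x ω (upperPair i j) : ℂ) * resolvent (symMatrix (x ω)) z j i‖
          ≤ |x ω (upperPair i j)| * c := by
        rw [norm_mul, Complex.norm_real, Real.norm_eq_abs]
        exact mul_le_mul_of_nonneg_left (hG _ _ _) (abs_nonneg _)
      have h2 : ‖(s : ℂ) * (resolvent (symMatrix (x ω)) z i i
          * resolvent (symMatrix (x ω)) z j j)‖ ≤ s * (c * c) := by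
        rw [norm_mul, norm_mul, Complex.norm_real, Real.norm_eq_abs, abs_of_nonneg hs]
        exact mul_le_mul_of_nonneg_left (mul_le_mul (hG _ _ _) (hG _ _ _) (norm_nonneg _) hc0) hs
      refine (mul_le_mul ((norm_add_le _ _).trans (add_le_add h1 h2)) (hB _) (norm_nonneg _)
        (by positivity)).trans (le_of_eq ?_)
      simp only [Pi.add_apply]
      ring)
  refine h.trans ?_
  simp only [Pi.add_apply]
  rw [integral_add (hi.const_mul _) (integrable_const _), integral_const_mul]
  simp only [integral_const, probReal_univ, one_smul]
  gcongr

theorem sum_integral_norm_sq_resolvent_le (hm : ∀ e, Measurable fun ω => x ω e) (hz : z.im ≠ 0) :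
    ∑ i, ∑ j, ∫ ω, ‖resolvent (symMatrix (x ω)) z j i‖ ^ 2 ∂P ≤ n * (1 / |z.im|) ^ 2 := by
  have hi : ∀ a b, Integrable (fun ω => ‖resolvent (symMatrix (x ω)) z a b‖ ^ 2) P := by
    intro a b
    refine Integrable.of_bound (C := (1 / |z.im|) ^ 2) ?_ (Eventually.of_forall fun ω => ?_)
    · exact ((((continuous_resolvent_symMatrix_apply hz a b).measurable).comp
        (measurable_pi_lambda x hm)).norm.pow_const 2).aestronglyMeasurable
    · rw [norm_pow, norm_norm]
      exact pow_le_pow_left₀ (norm_nonneg _)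
        (norm_resolvent_apply_le (symMatrix_isHermitian _) hz _ _) 2
  rw [Finset.sum_comm]
  have h : ∀ j : Fin n, ∑ i, ∫ ω, ‖resolvent (symMatrix (x ω)) z j i‖ ^ 2 ∂P
      ≤ (1 / |z.im|) ^ 2 := by
    intro j
    rw [← integral_finsetSum _ fun i _ => hi j i]
    calc _ ≤ ∫ ω, (1 / |z.im|) ^ 2 ∂P :=
          integral_mono (integrable_finsetSum _ fun i _ => hi j i) (integrable_const _)
            fun ω => sum_norm_sq_resolvent_le (symMatrix_isHermitian _) hz j
      _ = _ := by simp
  calc _ ≤ ∑ _j : Fin n, (1 / |z.im|) ^ 2 := Finset.sum_le_sum fun j _ => h j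
    _ = _ := by simp

/-- The second moment of the defect of the resolvent trace in the semicircle equation. -/
theorem integral_norm_sq_quadraticDefect_le (hn : n ≠ 0) {v : ℝ} (hv : 0 < v)
    (hm : ∀ e, Measurable fun ω => x ω e)
    (hx : iIndepFun (fun e ω => x ω e) P) (hL : ∀ e, MemLp (fun ω => x ω e) 2 P)
    (hz : z.im ≠ 0) {m : ℝ}
    (h1 : ∀ e, ∫ ω, x ω e ∂P = 0)
    (h2 : ∀ i j, i ≠ j → ∫ ω, x ω (upperPair i j) ^ 2 ∂P = v ^ 2 / n)
    (h2' : ∀ e, ∫ ω, x ω e ^ 2 ∂P ≤ 2 * (v ^ 2 / n))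
    (h3 : ∀ e, ∫ ω, |x ω e| * min |x ω e| (|x ω e| ^ 2) ∂P ≤ m)
    {c B K : ℝ} (hc : c = 1 / |z.im|) (hB : B = 1 + ‖z‖ * c + v ^ 2 * c ^ 2)
    (hK : K = (‖z‖ + 2 * v ^ 2 * c) * (2 * c ^ 2)) :
    ∫ ω, ‖quadraticDefect v z (symMatrix (x ω))‖ ^ 2 ∂P
      ≤ n * (4 * (c ^ 2 + c ^ 3) * B * m + c * (K / n) * (v ^ 2 / n)
          + (v ^ 2 / n) * ((c ^ 2 * (K / n) + 8 * c ^ 3 * B) * √(2 * (v ^ 2 / n))))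
        + (v ^ 2 / n) * B * c ^ 2
        + (c * B * √(2 * (v ^ 2 / n)) + (v ^ 2 / n) * c ^ 2 * B) := by
  have hn0 : (0 : ℝ) < n := by exact_mod_cast Nat.pos_of_ne_zero hn
  set s := v ^ 2 / n with hs
  have hs0 : 0 < s := by positivity
  have hc0 : 0 ≤ c := by rw [hc]; positivity
  have hB0 : 0 ≤ B := by rw [hB]; positivity
  have hK0 : 0 ≤ K := by rw [hK]; positivity
  set κ := √(2 * s) with hκ
  have hκ0 : 0 ≤ κ := Real.sqrt_nonneg _
  have hκe : ∀ e, ∫ ω, |x ω e| ∂P ≤ κ := fun e =>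
    integral_abs_le_sqrt (hL e) (by positivity) (h2' e)
  -- The sign of `m` follows from its being an upper bound, as soon as one entry exists.
  have hm0 : Nonempty (UpperPair n) → 0 ≤ m := fun ⟨e⟩ =>
    (integral_nonneg fun ω => mul_nonneg (abs_nonneg _)
      (le_min (abs_nonneg _) (sq_nonneg _))).trans (h3 e)
  -- With the conjugate defect as weight, the averaged entries sum to the squared modulus.
  let Φ : (UpperPair n → ℝ) → ℂ := fun y => star (quadraticDefect v z (symMatrix y))
  have hΦ : Measurable Φ := (continuous_quadraticDefect v hz).star.measurable
  have hΦB : ∀ y, ‖Φ y‖ ≤ B := fun y => by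
    rw [norm_star, hB, hc]
    exact norm_quadraticDefect_le v (symMatrix_isHermitian y) hz
  have hΦl : ∀ i j, i ≠ j → ∀ y, ‖Φ y - Φ (Function.update y (upperPair i j) 0)‖
      ≤ K / n * |y (upperPair i j)| := by
    intro i j hij y
    rw [← star_sub, norm_star]
    refine (norm_quadraticDefect_sub_update_le v y hz hij).trans (le_of_eq ?_)
    rw [hK, hc]
    ring
  let T : Fin n → Fin n → Ω → ℂ := fun i j ω =>
    ((x ω (upperPair i j) : ℂ) * resolvent (symMatrix (x ω)) z j i
        + (s : ℂ) * (resolvent (symMatrix (x ω)) z i i * resolvent (symMatrix (x ω)) z j j))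
        * Φ (x ω)
  have hT : ∀ i j, Integrable (T i j) P := fun i j => integrable_entry hm hL hz s i j hΦ hΦB
  set ε₁ := 4 * (c ^ 2 + c ^ 3) * B * m + c * (K / n) * s
    + s * ((c ^ 2 * (K / n) + 8 * c ^ 3 * B) * κ) with hε₁
  set ε₂ := c * B * κ + s * c ^ 2 * B with hε₂
  have hTb : ∀ i j, ‖∫ ω, T i j ω ∂P‖ ≤ ε₁
      + s * B * ∫ ω, ‖resolvent (symMatrix (x ω)) z j i‖ ^ 2 ∂P + if i = j then ε₂ else 0 := by
    intro i j
    by_cases hij : i = j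
    · have h := norm_integral_entry_le hL hz hs0.le i j (hκe _) hΦB
      rw [← hc] at h
      have hm1 := hm0 ⟨upperPair i j⟩
      have p1 : 0 ≤ ε₁ := by positivity
      have p2 : 0 ≤ s * B * ∫ ω, ‖resolvent (symMatrix (x ω)) z j i‖ ^ 2 ∂P :=
        mul_nonneg (mul_nonneg hs0.le hB0) (integral_nonneg fun ω => by positivity)
      rw [if_pos hij]
      refine h.trans ?_
      linarith
    · have h := norm_integral_entry_le_of_ne hm hx hL hz hs0.le hij (h1 _) (h2 i j hij)
        (h3 _) (hκe _) hΦ hΦB (by positivity) (hΦl i j hij)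
      rw [← hc] at h
      rw [if_neg hij, add_zero]
      exact h
  have hexp : ((∫ ω, ‖quadraticDefect v z (symMatrix (x ω))‖ ^ 2 ∂P : ℝ) : ℂ)
      = (n : ℂ)⁻¹ * ∑ i, ∑ j, ∫ ω, T i j ω ∂P := by
    rw [← integral_complex_ofReal]
    have e : ∀ ω, ((‖quadraticDefect v z (symMatrix (x ω))‖ ^ 2 : ℝ) : ℂ)
        = (n : ℂ)⁻¹ * ∑ i, ∑ j, T i j ω := by
      intro ω
      simp only [T, ← Finset.sum_mul]
      rw [← mul_assoc]
      have := quadraticDefect_eq_sum v hn (symMatrix_isHermitian (x ω)) hz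
      simp only [symMatrix_apply, ← hs] at this
      rw [← this, Complex.ofReal_pow]
      exact (Complex.mul_conj' _).symm
    simp_rw [e]
    rw [integral_const_mul, integral_finsetSum _ fun i _ => integrable_finsetSum _ fun j _ => hT i j]
    congr 1
    exact Finset.sum_congr rfl fun i _ => integral_finsetSum _ fun j _ => hT i j
  have hle : ∫ ω, ‖quadraticDefect v z (symMatrix (x ω))‖ ^ 2 ∂P
      ≤ (n : ℝ)⁻¹ * ∑ i, ∑ j, ‖∫ ω, T i j ω ∂P‖ := by
    have h := congrArg norm hexp
    rw [Complex.norm_real, Real.norm_eq_abs, norm_mul, norm_inv, Complex.norm_natCast] at h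
    refine (le_abs_self _).trans (h.le.trans ?_)
    gcongr
    exact (norm_sum_le _ _).trans (Finset.sum_le_sum fun i _ => norm_sum_le _ _)
  refine hle.trans ?_
  -- The three contributions are `n²` off-diagonal errors, the row-summable part of order `n s`, and
  -- `n` diagonal errors.
  have hsum : ∑ i, ∑ j, ‖∫ ω, T i j ω ∂P‖ ≤ n * (n * ε₁) + s * B * (n * c ^ 2) + n * ε₂ := by
    refine (Finset.sum_le_sum fun i _ => Finset.sum_le_sum fun j _ => hTb i j).trans ?_
    simp only [Finset.sum_add_distrib, ← Finset.mul_sum, Finset.sum_ite_eq, Finset.mem_univ,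
      if_true, Finset.sum_const, Finset.card_univ, Fintype.card_fin, nsmul_eq_mul]
    have := sum_integral_norm_sq_resolvent_le (P := P) hm hz
    rw [← hc] at this
    gcongr
  calc _ ≤ (n : ℝ)⁻¹ * (n * (n * ε₁) + s * B * (n * c ^ 2) + n * ε₂) := by gcongr
    _ = _ := by
      field_simp

end Expectation

/-! ### Moments of the diluted entries -/

section Entries

variable {Ω : Type*} [MeasurableSpace Ω] {P : Measure Ω} [IsProbabilityMeasure P]

/-- In terms of laws: the joint law is a product of two product measures, and regrouping the
coordinates turns it into a product over the pairs. -/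
theorem iIndepFun_prodMk_of_indepFun {ι β γ : Type*} [Fintype ι] [MeasurableSpace β]
    [MeasurableSpace γ] {X : ι → Ω → β} {Y : ι → Ω → γ} (hX : ∀ i, Measurable (X i))
    (hY : ∀ i, Measurable (Y i)) (iX : iIndepFun X P) (iY : iIndepFun Y P)
    (h : IndepFun (fun ω i => X i ω) (fun ω i => Y i ω) P) :
    iIndepFun (fun i ω => (X i ω, Y i ω)) P := by
  have hXY : ∀ i, Measurable fun ω => (X i ω, Y i ω) := fun i => (hX i).prodMk (hY i)
  rw [iIndepFun_iff_map_fun_eq_pi_map fun i => (hXY i).aemeasurable]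
  have h1 := (indepFun_iff_map_prod_eq_prod_map_map (measurable_pi_lambda _ hX).aemeasurable
    (measurable_pi_lambda _ hY).aemeasurable).1 h
  rw [(iIndepFun_iff_map_fun_eq_pi_map fun i => (hX i).aemeasurable).1 iX,
    (iIndepFun_iff_map_fun_eq_pi_map fun i => (hY i).aemeasurable).1 iY] at h1
  have h2 : ∀ i, P.map (fun ω => (X i ω, Y i ω)) = (P.map (X i)).prod (P.map (Y i)) := fun i =>
    (indepFun_iff_map_prod_eq_prod_map_map (hX i).aemeasurable (hY i).aemeasurable).1
      (h.comp (measurable_pi_apply i) (measurable_pi_apply i))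
  have : ∀ i, IsProbabilityMeasure (P.map (X i)) := fun i =>
    Measure.isProbabilityMeasure_map (hX i).aemeasurable
  have : ∀ i, IsProbabilityMeasure (P.map (Y i)) := fun i =>
    Measure.isProbabilityMeasure_map (hY i).aemeasurable
  simp_rw [h2]
  have h3 := (measurePreserving_arrowProdEquivProdArrow β γ ι (fun i => P.map (X i))
    (fun i => P.map (Y i))).symm
  rw [← h3.map_eq, ← h1, Measure.map_map h3.measurable
    ((measurable_pi_lambda _ hX).prodMk (measurable_pi_lambda _ hY))]
  rfl

variable {X D : Ω → ℝ} {q : ℝ}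

/-- The two disjoint events have probabilities adding up to one. -/
theorem ae_eq_zero_or_one_of_bernoulli (hD : Measurable D) (hq0 : 0 ≤ q) (hq1 : q ≤ 1)
    (h1 : P {ω | D ω = 1} = ENNReal.ofReal q) (h0 : P {ω | D ω = 0} = ENNReal.ofReal (1 - q)) :
    ∀ᵐ ω ∂P, D ω = 0 ∨ D ω = 1 := by
  have m0 : MeasurableSet {ω | D ω = 0} := hD (measurableSet_singleton 0)
  have m1 : MeasurableSet {ω | D ω = 1} := hD (measurableSet_singleton 1)
  have hd : Disjoint {ω | D ω = 0} {ω | D ω = 1} := by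
    rw [Set.disjoint_left]
    intro ω a b
    have a' : D ω = 0 := a
    have b' : D ω = 1 := b
    linarith
  have hu := measure_union (μ := P) hd m1
  rw [h0, h1, ← ENNReal.ofReal_add (by linarith) hq0, sub_add_cancel, ENNReal.ofReal_one] at hu
  exact (prob_compl_eq_zero_iff (m0.union m1)).2 hu

theorem integral_bernoulli (hD : Measurable D) (hq0 : 0 ≤ q) (hq1 : q ≤ 1)
    (h1 : P {ω | D ω = 1} = ENNReal.ofReal q) (h0 : P {ω | D ω = 0} = ENNReal.ofReal (1 - q)) :
    ∫ ω, D ω ∂P = q := by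
  have m1 : MeasurableSet {ω | D ω = 1} := hD (measurableSet_singleton 1)
  have e : D =ᵐ[P] {ω | D ω = 1}.indicator 1 := by
    filter_upwards [ae_eq_zero_or_one_of_bernoulli hD hq0 hq1 h1 h0] with ω hω
    rcases hω with h | h <;> simp [h]
  rw [integral_congr_ae e, integral_indicator_one m1, measureReal_def, h1,
    ENNReal.toReal_ofReal hq0]

theorem integral_comp_mul_bernoulli (hX : Measurable X) (hD : Measurable D) (hXD : IndepFun X D P)
    (hq0 : 0 ≤ q) (hq1 : q ≤ 1) (h1 : P {ω | D ω = 1} = ENNReal.ofReal q)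
    (h0 : P {ω | D ω = 0} = ENNReal.ofReal (1 - q)) {f : ℝ → ℝ} (hf : Measurable f) :
    ∫ ω, f (X ω) * D ω ∂P = (∫ ω, f (X ω) ∂P) * q := by
  have h := (hXD.comp hf measurable_id).integral_fun_mul_eq_mul_integral
    (hf.comp hX).aestronglyMeasurable hD.aestronglyMeasurable
  simp only [Function.comp, id] at h
  rw [h, integral_bernoulli hD hq0 hq1 h1 h0]

/-- The left side is `t³` below 1 and `t²` above; an exponent between 2 and 3 dominates both. -/
theorem mul_min_le_rpow {t r : ℝ} (ht : 0 ≤ t) (hr0 : 0 ≤ r) (hr1 : r ≤ 1) :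
    t * min t (t ^ 2) ≤ t ^ (2 + r) := by
  rcases ht.eq_or_lt with rfl | ht0
  · simp [Real.zero_rpow (by linarith : 2 + r ≠ 0)]
  · by_cases h : t ≤ 1
    · calc t * min t (t ^ 2) ≤ t * t ^ 2 := mul_le_mul_of_nonneg_left (min_le_right _ _) ht
        _ = t ^ (3 : ℝ) := by
          rw [show (3 : ℝ) = ((3 : ℕ) : ℝ) by norm_num, Real.rpow_natCast]; ring
        _ ≤ _ := Real.rpow_le_rpow_of_exponent_ge ht0 h (by linarith)
    · calc t * min t (t ^ 2) ≤ t * t := mul_le_mul_of_nonneg_left (min_le_left _ _) ht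
        _ = t ^ (2 : ℝ) := by
          rw [show (2 : ℝ) = ((2 : ℕ) : ℝ) by norm_num, Real.rpow_natCast]; ring
        _ ≤ _ := Real.rpow_le_rpow_of_exponent_le (not_le.1 h).le (by linarith)

theorem rpow_le_one_add_rpow {t a b : ℝ} (ht : 0 ≤ t) (ha : 0 ≤ a) (hab : a ≤ b) :
    t ^ a ≤ 1 + t ^ b := by
  by_cases h : t ≤ 1
  · linarith [Real.rpow_le_one ht h ha, Real.rpow_nonneg ht b]
  · linarith [Real.rpow_le_rpow_of_exponent_le (not_le.1 h).le hab]

variable {p : ℝ}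

theorem integral_scaled_entry (hX : Measurable X) (hD : Measurable D) (hXD : IndepFun X D P)
    (hq0 : 0 ≤ q) (hq1 : q ≤ 1) (h1 : P {ω | D ω = 1} = ENNReal.ofReal q)
    (h0 : P {ω | D ω = 0} = ENNReal.ofReal (1 - q)) (hX0 : ∫ ω, X ω ∂P = 0) :
    ∫ ω, 1 / √p * X ω * D ω ∂P = 0 := by
  have h := integral_comp_mul_bernoulli hX hD hXD hq0 hq1 h1 h0 (f := fun t => 1 / √p * t)
    (by fun_prop)
  rw [h, integral_const_mul, hX0]
  simp

theorem integral_scaled_entry_sq (hX : Measurable X) (hD : Measurable D) (hXD : IndepFun X D P)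
    (hq0 : 0 ≤ q) (hq1 : q ≤ 1) (h1 : P {ω | D ω = 1} = ENNReal.ofReal q)
    (h0 : P {ω | D ω = 0} = ENNReal.ofReal (1 - q)) (hp : 0 < p) :
    ∫ ω, (1 / √p * X ω * D ω) ^ 2 ∂P = (∫ ω, X ω ^ 2 ∂P) * q / p := by
  have h := integral_comp_mul_bernoulli hX hD hXD hq0 hq1 h1 h0 (f := fun t => p⁻¹ * t ^ 2)
    (by fun_prop)
  -- Almost surely `D² = D`, so the square is again linear in the Bernoulli variable.
  have e : ∀ᵐ ω ∂P, (1 / √p * X ω * D ω) ^ 2 = p⁻¹ * X ω ^ 2 * D ω := by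
    filter_upwards [ae_eq_zero_or_one_of_bernoulli hD hq0 hq1 h1 h0] with ω hω
    have hs := Real.sq_sqrt hp.le
    rcases hω with h | h
    · simp [h]
    · rw [h, mul_one, mul_one, mul_pow, div_pow, hs]
      simp
  rw [integral_congr_ae e, h, integral_const_mul]
  ring

theorem memLp_scaled_entry (hX : Measurable X) (hD : Measurable D)
    (hq0 : 0 ≤ q) (hq1 : q ≤ 1) (h1 : P {ω | D ω = 1} = ENNReal.ofReal q)
    (h0 : P {ω | D ω = 0} = ENNReal.ofReal (1 - q)) (hX2 : MemLp X 2 P) :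
    MemLp (fun ω => 1 / √p * X ω * D ω) 2 P := by
  refine (hX2.const_mul (1 / √p)).mono (by fun_prop) ?_
  filter_upwards [ae_eq_zero_or_one_of_bernoulli hD hq0 hq1 h1 h0] with ω hω
  rcases hω with h | h
  · rw [h, mul_zero, norm_zero]
    exact norm_nonneg _
  · rw [h, mul_one]

/-- Scaling contributes `√p ^ -(2 + r)` and dilution a factor `q`. For `q = p / n` the bound is `(1
+ M) / (n √p ^ r)`, smaller than the variance scale `1 / n` by a power of `p`. -/
theorem integral_scaled_entry_mul_min_le (hX : Measurable X) (hD : Measurable D)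
    (hXD : IndepFun X D P) (hq0 : 0 ≤ q) (hq1 : q ≤ 1)
    (h1 : P {ω | D ω = 1} = ENNReal.ofReal q)
    (h0 : P {ω | D ω = 0} = ENNReal.ofReal (1 - q)) (hp : 0 < p) {r ρ M : ℝ} (hr0 : 0 ≤ r)
    (hr1 : r ≤ 1) (hrρ : r ≤ ρ) (hi : Integrable (fun ω => |X ω| ^ (2 + ρ)) P)
    (hM : ∫ ω, |X ω| ^ (2 + ρ) ∂P ≤ M) :
    ∫ ω, |1 / √p * X ω * D ω| * min |1 / √p * X ω * D ω| (|1 / √p * X ω * D ω| ^ 2) ∂P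
      ≤ (1 + M) * q / (p * √p ^ r) := by
  have hs : 0 < √p := Real.sqrt_pos.2 hp
  have hsr : √p ^ (2 + r) = p * √p ^ r := by
    rw [Real.rpow_add hs, show (2 : ℝ) = ((2 : ℕ) : ℝ) by norm_num, Real.rpow_natCast,
      Real.sq_sqrt hp.le]
  have hf : Measurable fun t : ℝ => (√p ^ (2 + r))⁻¹ * (1 + |t| ^ (2 + ρ)) := by fun_prop
  have h := integral_comp_mul_bernoulli hX hD hXD hq0 hq1 h1 h0 hf
  have hint : Integrable (fun ω => (√p ^ (2 + r))⁻¹ * (1 + |X ω| ^ (2 + ρ))) P :=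
    ((integrable_const 1).add hi).const_mul _
  have hae := ae_eq_zero_or_one_of_bernoulli hD hq0 hq1 h1 h0
  have hint2 : Integrable (fun ω => (√p ^ (2 + r))⁻¹ * (1 + |X ω| ^ (2 + ρ)) * D ω) P := by
    refine hint.mul_bdd (c := 1) hD.aestronglyMeasurable ?_
    filter_upwards [hae] with ω hω
    rcases hω with h | h <;> simp [h]
  calc _ ≤ ∫ ω, (√p ^ (2 + r))⁻¹ * (1 + |X ω| ^ (2 + ρ)) * D ω ∂P := by
        refine integral_mono_of_nonneg (Eventually.of_forall fun ω => ?_) hint2 ?_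
        · exact mul_nonneg (abs_nonneg _) (le_min (abs_nonneg _) (sq_nonneg _))
        · filter_upwards [hae] with ω hω
          rcases hω with h | h
          · simp [h]
          · rw [h, mul_one, mul_one, abs_mul, abs_of_pos (one_div_pos.2 hs)]
            have hx := abs_nonneg (X ω)
            refine (mul_min_le_rpow (by positivity) hr0 hr1).trans ?_
            rw [Real.mul_rpow (by positivity) hx, one_div, Real.inv_rpow hs.le]
            exact mul_le_mul_of_nonneg_left (rpow_le_one_add_rpow hx (by linarith) (by linarith))
              (by positivity)
    _ = (√p ^ (2 + r))⁻¹ * (1 + ∫ ω, |X ω| ^ (2 + ρ) ∂P) * q := by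
        rw [h, integral_const_mul, integral_add (integrable_const 1) hi]
        simp
    _ ≤ (√p ^ (2 + r))⁻¹ * (1 + M) * q := by gcongr
    _ = _ := by
        rw [hsr]
        field_simp

end Entries

/-! ### The joint limit -/

section Convergence

variable {Ω : Type*} [MeasurableSpace Ω] {P : Measure Ω} {v : ℝ}
  {a : (n : ℕ) → Fin n → Fin n → Ω → ℝ} {d : (n : ℕ) → ℝ → Fin n → Fin n → Ω → ℝ} {z : ℂ}

theorem lintegral_le_absMoment (r : ℝ) {n : ℕ} {i j : Fin n} (hij : i ≤ j) :
    ∫⁻ ω, ENNReal.ofReal (|a n i j ω| ^ r) ∂P ≤ absMoment P a r :=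
  le_iSup_of_le n (le_iSup_of_le i (le_iSup_of_le j (le_iSup_of_le hij le_rfl)))

theorem integrable_of_absMoment_lt_top {r : ℝ} (ha : IsWignerFamily P v a)
    (hμ : absMoment P a r < ∞) {n : ℕ} {i j : Fin n} (hij : i ≤ j) :
    Integrable (fun ω => |a n i j ω| ^ r) P := by
  have hm := ha.measurable n i j hij
  refine ⟨(by fun_prop : Measurable _).aestronglyMeasurable, ?_⟩
  rw [hasFiniteIntegral_iff_ofReal (Eventually.of_forall fun ω => by positivity)]
  exact (lintegral_le_absMoment r hij).trans_lt hμ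

theorem integral_le_absMoment {r : ℝ} (ha : IsWignerFamily P v a)
    (hμ : absMoment P a r < ∞) {n : ℕ} {i j : Fin n} (hij : i ≤ j) :
    ∫ ω, |a n i j ω| ^ r ∂P ≤ (absMoment P a r).toReal := by
  rw [integral_eq_lintegral_of_nonneg_ae (Eventually.of_forall fun ω => by positivity)
    (integrable_of_absMoment_lt_top ha hμ hij).1]
  exact ENNReal.toReal_mono hμ.ne (lintegral_le_absMoment r hij)

theorem memLp_two_of_isWignerFamily (hv : 0 < v) (ha : IsWignerFamily P v a) {n : ℕ}
    {i j : Fin n} (hij : i ≤ j) : MemLp (a n i j) 2 P := by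
  rw [memLp_two_iff_integrable_sq (ha.measurable n i j hij).aestronglyMeasurable]
  -- A nonintegrable function has integral zero by convention, so a positive variance forces square
  -- integrability.
  refine Integrable.of_integral_ne_zero ?_
  rw [ha.variance n i j hij]
  split_ifs <;> positivity

/-- The upper triangle of the dilute matrix. -/
noncomputable def diluteEntries (a : (n : ℕ) → Fin n → Fin n → Ω → ℝ)
    (d : (n : ℕ) → ℝ → Fin n → Fin n → Ω → ℝ) (n : ℕ) (p : ℝ) (ω : Ω) (e : UpperPair n) : ℝ :=
  1 / √p * a n e.1.1 e.1.2 ω * d n p e.1.1 e.1.2 ω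

theorem measurable_diluteEntries (ha : IsWignerFamily P v a) (hd : IsDilutionFamily P d)
    {n : ℕ} {p : ℝ} (hp : 0 < p) (hpn : p ≤ n) : Measurable (diluteEntries a d n p) :=
  measurable_pi_lambda _ fun e =>
    (measurable_const.mul (ha.measurable n _ _ e.2)).mul (hd.measurable n p hp hpn _ _ e.2)

theorem tendsto_fst_jointLimit : Tendsto (fun q : ℕ × ℝ => q.1) jointLimit atTop :=
  tendsto_fst.mono_left inf_le_left

theorem tendsto_snd_jointLimit : Tendsto (fun q : ℕ × ℝ => q.2) jointLimit atTop :=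
  tendsto_snd.mono_left inf_le_left

theorem eventually_jointLimit : ∀ᶠ q : ℕ × ℝ in jointLimit, 0 < q.2 ∧ q.2 ≤ q.1 :=
  mem_inf_of_right (mem_principal_self _)

theorem eventually_inMeasureFilter_ne_zero :
    ∀ᶠ y : (ℕ × ℝ) × Ω in inMeasureFilter P jointLimit, y.1.1 ≠ 0 :=
  eventually_inMeasureFilter_of_eventually (tendsto_fst_jointLimit.eventually_ne_atTop 0)

variable [IsProbabilityMeasure P]

theorem integral_norm_sq_quadraticDefect_dilute_le (hv : 0 < v) (ha : IsWignerFamily P v a)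
    (hd : IsDilutionFamily P d) (had : FamiliesIndep P a d) {ρ : ℝ} (hρ : 0 < ρ)
    (hμ : absMoment P a (2 + ρ) < ∞) (hz : z.im ≠ 0) {n : ℕ} {p : ℝ} (hp : 0 < p) (hpn : p ≤ n)
    {c B K : ℝ} (hc : c = 1 / |z.im|) (hB : B = 1 + ‖z‖ * c + v ^ 2 * c ^ 2)
    (hK : K = (‖z‖ + 2 * v ^ 2 * c) * (2 * c ^ 2)) :
    ∫ ω, ‖quadraticDefect v z (symMatrix (diluteEntries a d n p ω))‖ ^ 2 ∂P
      ≤ 4 * (c ^ 2 + c ^ 3) * B * (1 + (absMoment P a (2 + ρ)).toReal) * (√p ^ min ρ 1)⁻¹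
        + c * K * v ^ 2 * (n : ℝ)⁻¹
        + v ^ 2 * (c ^ 2 * K * (n : ℝ)⁻¹ + 8 * c ^ 3 * B) * √(2 * v ^ 2 * (n : ℝ)⁻¹)
        + v ^ 2 * (n : ℝ)⁻¹ * B * c ^ 2
        + (c * B * √(2 * v ^ 2 * (n : ℝ)⁻¹) + v ^ 2 * (n : ℝ)⁻¹ * c ^ 2 * B) := by
  have hn0 : (0 : ℝ) < n := hp.trans_le hpn
  have hn : n ≠ 0 := by rintro rfl; simp at hn0
  have hq0 : 0 ≤ p / n := by positivity
  have hq1 : p / n ≤ 1 := (div_le_one hn0).2 hpn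
  have hma : ∀ e : UpperPair n, Measurable (a n e.1.1 e.1.2) := fun e => ha.measurable n _ _ e.2
  have hmd : ∀ e : UpperPair n, Measurable (d n p e.1.1 e.1.2) := fun e =>
    hd.measurable n p hp hpn _ _ e.2
  have hd1 : ∀ e : UpperPair n, P {ω | d n p e.1.1 e.1.2 ω = 1} = ENNReal.ofReal (p / n) :=
    fun e => hd.prob_one n p hp hpn _ _ e.2
  have hd0 : ∀ e : UpperPair n, P {ω | d n p e.1.1 e.1.2 ω = 0} = ENNReal.ofReal (1 - p / n) :=
    fun e => hd.prob_zero n p hp hpn _ _ e.2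
  have hI : ∀ e : UpperPair n, IndepFun (a n e.1.1 e.1.2) (d n p e.1.1 e.1.2) P := fun e =>
    (had n p hp hpn).comp (measurable_pi_apply e) (measurable_pi_apply e)
  have hL : ∀ e : UpperPair n, MemLp (a n e.1.1 e.1.2) 2 P := fun e =>
    memLp_two_of_isWignerFamily hv ha e.2
  have hm : ∀ e, Measurable fun ω => diluteEntries a d n p ω e := fun e =>
    (measurable_const.mul (hma e)).mul (hmd e)
  have hind : iIndepFun (fun e ω => diluteEntries a d n p ω e) P :=
    (iIndepFun_prodMk_of_indepFun hma hmd (ha.indep n) (hd.indep n p hp hpn)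
      (had n p hp hpn)).comp (fun _ (t : ℝ × ℝ) => 1 / √p * t.1 * t.2) fun _ => by fun_prop
  have hsq : ∀ e : UpperPair n, ∫ ω, diluteEntries a d n p ω e ^ 2 ∂P
      = (1 + if e.1.1 = e.1.2 then 1 else 0) * (v ^ 2 / n) := by
    intro e
    have h := integral_scaled_entry_sq (hma e) (hmd e) (hI e) hq0 hq1 (hd1 e) (hd0 e) hp
    rw [ha.variance n _ _ e.2] at h
    refine h.trans ?_
    field_simp
  have key := integral_norm_sq_quadraticDefect_le hn hv hm hind
    (fun e => memLp_scaled_entry (hma e) (hmd e) hq0 hq1 (hd1 e) (hd0 e) (hL e)) hz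
    (fun e => integral_scaled_entry (hma e) (hmd e) (hI e) hq0 hq1 (hd1 e) (hd0 e)
      (ha.mean n _ _ e.2))
    (fun i j hij => by
      have hne : (upperPair i j).1.1 ≠ (upperPair i j).1.2 := by simpa [upperPair] using hij
      rw [hsq, if_neg hne, add_zero, one_mul])
    (fun e => by
      rw [hsq]
      refine mul_le_mul_of_nonneg_right ?_ (by positivity)
      split_ifs <;> norm_num)
    -- The exponent is capped at 1 because the resolvent remainder gains at most a third power of
    -- the entry.
    (fun e => integral_scaled_entry_mul_min_le (hma e) (hmd e) (hI e) hq0 hq1 (hd1 e) (hd0 e) hp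
      (le_min hρ.le zero_le_one) (min_le_right ρ 1) (min_le_left ρ 1)
      (integrable_of_absMoment_lt_top ha hμ e.2) (integral_le_absMoment ha hμ e.2)) hc hB hK
  refine key.trans (le_of_eq ?_)
  have hr : 0 < √p ^ min ρ 1 := Real.rpow_pos_of_pos (Real.sqrt_pos.2 hp) _
  rw [show 2 * (v ^ 2 / n) = 2 * v ^ 2 * (n : ℝ)⁻¹ by ring]
  generalize √(2 * v ^ 2 * (n : ℝ)⁻¹) = κ
  field_simp

/-- The bound is a continuous function of `1 / n` and `√p ^ -min ρ 1` that vanishes at the origin.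
Both variables tend to zero in the joint limit, so no relative rate of `p` and `n` matters. -/
theorem tendsto_integral_norm_sq_quadraticDefect (hv : 0 < v) (ha : IsWignerFamily P v a)
    (hd : IsDilutionFamily P d) (had : FamiliesIndep P a d) {ρ : ℝ} (hρ : 0 < ρ)
    (hμ : absMoment P a (2 + ρ) < ∞) (hz : z.im ≠ 0) :
    Tendsto (fun q : ℕ × ℝ =>
      ∫ ω, ‖quadraticDefect v z (symMatrix (diluteEntries a d q.1 q.2 ω))‖ ^ 2 ∂P)
      jointLimit (𝓝 0) := by
  obtain ⟨c, hc⟩ : ∃ c, c = 1 / |z.im| := ⟨_, rfl⟩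
  obtain ⟨B, hB⟩ : ∃ B, B = 1 + ‖z‖ * c + v ^ 2 * c ^ 2 := ⟨_, rfl⟩
  obtain ⟨K, hK⟩ : ∃ K, K = (‖z‖ + 2 * v ^ 2 * c) * (2 * c ^ 2) := ⟨_, rfl⟩
  have hu : Tendsto (fun q : ℕ × ℝ => (q.1 : ℝ)⁻¹) jointLimit (𝓝 0) :=
    tendsto_inv_atTop_zero.comp (tendsto_natCast_atTop_atTop.comp tendsto_fst_jointLimit)
  have hy : Tendsto (fun q : ℕ × ℝ => (√q.2 ^ min ρ 1)⁻¹) jointLimit (𝓝 0) :=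
    tendsto_inv_atTop_zero.comp ((tendsto_rpow_atTop (lt_min hρ one_pos)).comp
      (Real.tendsto_sqrt_atTop.comp tendsto_snd_jointLimit))
  have hcont : Continuous fun t : ℝ × ℝ =>
      4 * (c ^ 2 + c ^ 3) * B * (1 + (absMoment P a (2 + ρ)).toReal) * t.2
        + c * K * v ^ 2 * t.1
        + v ^ 2 * (c ^ 2 * K * t.1 + 8 * c ^ 3 * B) * √(2 * v ^ 2 * t.1)
        + v ^ 2 * t.1 * B * c ^ 2
        + (c * B * √(2 * v ^ 2 * t.1) + v ^ 2 * t.1 * c ^ 2 * B) := by fun_prop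
  have hlim := (hcont.tendsto (0, 0)).comp (hu.prodMk_nhds hy)
  simp only [mul_zero, zero_mul, add_zero, Real.sqrt_zero] at hlim
  refine tendsto_of_tendsto_of_tendsto_of_le_of_le' tendsto_const_nhds hlim
    (Eventually.of_forall fun q => integral_nonneg fun ω => by positivity) ?_
  filter_upwards [eventually_jointLimit] with q hq
  exact integral_norm_sq_quadraticDefect_dilute_le hv ha hd had hρ hμ hz hq.1 hq.2 hc hB hK

theorem tendsto_quadraticDefect (hv : 0 < v) (ha : IsWignerFamily P v a)
    (hd : IsDilutionFamily P d) (had : FamiliesIndep P a d) {ρ : ℝ} (hρ : 0 < ρ)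
    (hμ : absMoment P a (2 + ρ) < ∞) (hz : z.im ≠ 0) :
    Tendsto (fun y : (ℕ × ℝ) × Ω =>
      quadraticDefect v z (symMatrix (diluteEntries a d y.1.1 y.1.2 y.2)))
      (inMeasureFilter P jointLimit) (𝓝 0) := by
  rw [Metric.tendsto_nhds]
  intro ε hε
  rw [Filter.Eventually, mem_inMeasureFilter]
  have h := (tendsto_integral_norm_sq_quadraticDefect (P := P) hv ha hd had hρ hμ hz).div_const
    (ε ^ 2)
  rw [zero_div] at h
  have h2 := ENNReal.tendsto_ofReal h
  rw [ENNReal.ofReal_zero] at h2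
  refine tendsto_of_tendsto_of_tendsto_of_le_of_le' tendsto_const_nhds h2
    (Eventually.of_forall fun _ => zero_le) ?_
  filter_upwards [eventually_jointLimit] with q hq
  set f : Ω → ℝ := fun ω => ‖quadraticDefect v z (symMatrix (diluteEntries a d q.1 q.2 ω))‖ ^ 2
    with hf
  have hfm : Measurable f := (((continuous_quadraticDefect v hz).measurable.comp
    (measurable_diluteEntries ha hd hq.1 hq.2)).norm).pow_const 2
  have hfi : Integrable f P := by
    refine Integrable.of_bound hfm.aestronglyMeasurable
      ((1 + ‖z‖ * (1 / |z.im|) + v ^ 2 * (1 / |z.im|) ^ 2) ^ 2) (Eventually.of_forall fun ω => ?_)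
    rw [hf, norm_pow, norm_norm]
    exact pow_le_pow_left₀ (norm_nonneg _)
      (norm_quadraticDefect_le v (symMatrix_isHermitian _) hz) 2
  -- Markov's inequality for the squared modulus.
  have hmk := mul_meas_ge_le_integral_of_nonneg
    (Eventually.of_forall fun ω => (by positivity : 0 ≤ f ω)) hfi (ε ^ 2)
  have hsub : {ω | (q, ω) ∉ {y : (ℕ × ℝ) × Ω | dist (quadraticDefect v z
      (symMatrix (diluteEntries a d y.1.1 y.1.2 y.2))) 0 < ε}} ⊆ {ω | ε ^ 2 ≤ f ω} := by
    intro ω hω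
    have hω' : ¬ dist (quadraticDefect v z
      (symMatrix (diluteEntries a d q.1 q.2 ω))) 0 < ε := hω
    rw [dist_zero_right, not_lt] at hω'
    exact pow_le_pow_left₀ hε.le hω' 2
  refine (measure_mono hsub).trans ?_
  rw [← ofReal_measureReal]
  refine ENNReal.ofReal_le_ofReal ?_
  rw [le_div_iff₀ (by positivity), mul_comm]
  exact hmk

theorem tendsto_resolventTrace (hv : 0 < v) (ha : IsWignerFamily P v a)
    (hd : IsDilutionFamily P d) (had : FamiliesIndep P a d) {ρ : ℝ} (hρ : 0 < ρ)
    (hμ : absMoment P a (2 + ρ) < ∞) (hz : z.im ≠ 0) :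
    Tendsto (fun y : (ℕ × ℝ) × Ω => resolventTrace
        (diluteMatrix y.1.2 (fun i j => a y.1.1 i j y.2) (fun i j => d y.1.1 y.1.2 i j y.2)) z)
      (inMeasureFilter P jointLimit) (𝓝 (stieltjes (semicircleMeasure v) z)) := by
  have := isProbabilityMeasure_semicircleMeasure hv
  rw [tendsto_iff_norm_sub_tendsto_zero]
  have h := ((tendsto_quadraticDefect hv ha hd had hρ hμ hz).norm).div_const |z.im|
  rw [norm_zero, zero_div] at h
  refine squeeze_zero (fun _ => norm_nonneg _) (fun y => ?_) h
  rw [le_div_iff₀ (abs_pos.2 hz)]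
  -- `diluteMatrix` and `symMatrix` of `diluteEntries` agree by unfolding, so the stability estimate
  -- matches the defect controlled above.
  refine norm_sub_mul_abs_im_le (stieltjes_semicircleMeasure_quadratic hv hz)
    (im_stieltjes_mul_im_pos _ hz).le ?_
  -- The empty matrix has trace zero and carries no spectral probability measure, so it is treated
  -- apart.
  by_cases hn : y.1.1 = 0
  · have h0 : (y.1.1 : ℂ)⁻¹ = 0 := by rw [hn]; simp
    rw [resolventTrace, h0]
    simp
  · have hH := diluteMatrix_isHermitian y.1.2 (fun i j => a y.1.1 i j y.2)
      (fun i j => d y.1.1 y.1.2 i j y.2)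
    have := isProbabilityMeasure_spectralMeasure hH hn
    rw [← stieltjes_spectralMeasure hH hz]
    exact (im_stieltjes_mul_im_pos _ hz).le

/-- The spectral measure as a probability measure, with a conventional value for the empty
matrix. -/
noncomputable def spectralProbabilityMeasure {n : ℕ} {A : Matrix (Fin n) (Fin n) ℝ}
    (hA : A.IsHermitian) : ProbabilityMeasure ℝ :=
  ⟨if n = 0 then Measure.dirac 0 else spectralMeasure hA, by
    split_ifs with hn
    · infer_instance
    · exact isProbabilityMeasure_spectralMeasure hA hn⟩

theorem coe_spectralProbabilityMeasure {n : ℕ} {A : Matrix (Fin n) (Fin n) ℝ}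
    (hA : A.IsHermitian) (hn : n ≠ 0) :
    (spectralProbabilityMeasure hA : Measure ℝ) = spectralMeasure hA :=
  if_neg hn

/-- Weak convergence of the spectral measures, along the events of high probability. -/
theorem tendsto_spectralProbabilityMeasure (hv : 0 < v) (ha : IsWignerFamily P v a)
    (hd : IsDilutionFamily P d) (had : FamiliesIndep P a d) {ρ : ℝ} (hρ : 0 < ρ)
    (hμ : absMoment P a (2 + ρ) < ∞) :
    Tendsto (fun y : (ℕ × ℝ) × Ω => spectralProbabilityMeasure
        (diluteMatrix_isHermitian y.1.2 (fun i j => a y.1.1 i j y.2)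
          (fun i j => d y.1.1 y.1.2 i j y.2)))
      (inMeasureFilter P jointLimit)
      (𝓝 ⟨semicircleMeasure v, isProbabilityMeasure_semicircleMeasure hv⟩) := by
  refine tendsto_of_tendsto_stieltjes fun z hz => ?_
  refine (tendsto_resolventTrace hv ha hd had hρ hμ hz).congr' ?_
  filter_upwards [eventually_inMeasureFilter_ne_zero] with y hy
  rw [coe_spectralProbabilityMeasure _ hy, stieltjes_spectralMeasure _ hz]

end Convergence

end DiluteWigner

/-! ### The limit theorem -/

theorem theorem2p1 {Ω : Type*} [MeasurableSpace Ω] (P : Measure Ω) [IsProbabilityMeasure P]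
    (v : ℝ) (hv : 0 < v)
    (a : (n : ℕ) → Fin n → Fin n → Ω → ℝ) (d : (n : ℕ) → ℝ → Fin n → Fin n → Ω → ℝ)
    (ha : DiluteWigner.IsWignerFamily P v a)
    (hd : DiluteWigner.IsDilutionFamily P d)
    (had : DiluteWigner.FamiliesIndep P a d)
    (ρ : ℝ) (hρ : 0 < ρ) (hμ : DiluteWigner.absMoment P a (2 + ρ) < ∞) :
    ∃ w : ℂ → ℂ,
      -- `w z` is the unique solution of the equation with `Im w · Im z > 0`
      (∀ z : ℂ, z.im ≠ 0 →
        (w z = 1 / (-z - (v : ℂ) ^ 2 * w z) ∧ 0 < (w z).im * z.im) ∧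
        ∀ u : ℂ, u = 1 / (-z - (v : ℂ) ^ 2 * u) → 0 < u.im * z.im → u = w z) ∧
      -- convergence in probability of the normalized trace of the resolvent
      (∀ z : ℂ, 2 * v + 1 ≤ |z.im| →
        TendstoInMeasure P
          (fun (q : ℕ × ℝ) ω => DiluteWigner.resolventTrace
            (DiluteWigner.diluteMatrix q.2 (fun i j => a q.1 i j ω)
              (fun i j => d q.1 q.2 i j ω)) z)
          DiluteWigner.jointLimit (fun _ => w z)) ∧
      -- `w` is the Stieltjes transform of the semicircle law and determines it
      (∀ z : ℂ, z.im ≠ 0 →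
        w z = DiluteWigner.stieltjes (DiluteWigner.semicircleMeasure v) z) ∧
      (∀ ν : Measure ℝ, IsProbabilityMeasure ν →
        (∀ z : ℂ, z.im ≠ 0 → w z = DiluteWigner.stieltjes ν z) →
          ν = DiluteWigner.semicircleMeasure v) ∧
      -- weak convergence in probability: tested on bounded continuous functions,
      -- and in terms of the distribution functions
      (∀ f : ℝ →ᵇ ℝ,
        TendstoInMeasure P
          (fun (q : ℕ × ℝ) ω => ∫ x, f x ∂(DiluteWigner.spectralMeasure
            (DiluteWigner.diluteMatrix_isHermitian q.2 (fun i j => a q.1 i j ω)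
              (fun i j => d q.1 q.2 i j ω))))
          DiluteWigner.jointLimit
          (fun _ => ∫ x, f x ∂(DiluteWigner.semicircleMeasure v))) ∧
      (∀ t : ℝ,
        TendstoInMeasure P
          (fun (q : ℕ × ℝ) ω => DiluteWigner.eigenvalueCount
            (DiluteWigner.diluteMatrix_isHermitian q.2 (fun i j => a q.1 i j ω)
              (fun i j => d q.1 q.2 i j ω)) t)
          DiluteWigner.jointLimit (fun _ => DiluteWigner.semicircleCDF v t)) := by
  have hprob := DiluteWigner.isProbabilityMeasure_semicircleMeasure hv
  have hquad := fun {z : ℂ} (hz : z.im ≠ 0) =>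
    DiluteWigner.stieltjes_semicircleMeasure_quadratic hv hz
  have hpos := fun {z : ℂ} (hz : z.im ≠ 0) =>
    DiluteWigner.im_stieltjes_mul_im_pos (DiluteWigner.semicircleMeasure v) hz
  have hne : ∀ {u z : ℂ}, 0 < u.im * z.im → u ≠ 0 := by
    rintro u z h rfl
    simp at h
  have hweak := DiluteWigner.tendsto_spectralProbabilityMeasure hv ha hd had hρ hμ
  refine ⟨DiluteWigner.stieltjes (DiluteWigner.semicircleMeasure v), ?_, ?_, fun z _ => rfl, ?_,
    ?_, ?_⟩
  · intro z hz
    refine ⟨⟨(DiluteWigner.eq_one_div_iff_quadratic (hne (hpos hz))).2 (hquad hz), hpos hz⟩, ?_⟩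
    intro u hu huz
    -- Uniqueness is the stability estimate with zero defect.
    have h := DiluteWigner.norm_sub_mul_abs_im_le (hquad hz) (hpos hz).le huz.le
    rw [(DiluteWigner.eq_one_div_iff_quadratic (hne huz)).1 hu, norm_zero] at h
    have h0 : ‖u - DiluteWigner.stieltjes (DiluteWigner.semicircleMeasure v) z‖ ≤ 0 :=
      le_of_mul_le_mul_right (by rwa [zero_mul]) (abs_pos.2 hz)
    exact sub_eq_zero.1 (norm_le_zero_iff.1 h0)
  · intro z hz
    have hz0 : z.im ≠ 0 := abs_pos.1 (by linarith)
    exact DiluteWigner.tendstoInMeasure_const_iff.2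
      (DiluteWigner.tendsto_resolventTrace hv ha hd had hρ hμ hz0)
  · intro ν hν h
    exact DiluteWigner.eq_of_stieltjes_eq fun z hz => (h z hz).symm
  · intro f
    rw [DiluteWigner.tendstoInMeasure_const_iff]
    refine (ProbabilityMeasure.tendsto_iff_forall_integral_tendsto.1 hweak f).congr' ?_
    filter_upwards [DiluteWigner.eventually_inMeasureFilter_ne_zero] with y hy
    rw [DiluteWigner.coe_spectralProbabilityMeasure _ hy]
  · intro t
    rw [DiluteWigner.tendstoInMeasure_const_iff, ← DiluteWigner.semicircleMeasure_real_Iic hv]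
    -- The law has a density, so it has no atom at `t` and half-lines are continuity sets.
    have hfr : DiluteWigner.semicircleMeasure v (frontier (Set.Iic t)) = 0 := by
      rw [frontier_Iic, DiluteWigner.semicircleMeasure_apply hv (measurableSet_singleton t)]
      simp
    have h := ProbabilityMeasure.tendsto_measure_of_null_frontier_of_tendsto' hweak hfr
    refine ((ENNReal.tendsto_toReal (measure_ne_top (DiluteWigner.semicircleMeasure v) _)).comp h).congr' ?_
    filter_upwards [DiluteWigner.eventually_inMeasureFilter_ne_zero] with y hy
    rw [DiluteWigner.eigenvalueCount_eq, Function.comp_apply,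
      DiluteWigner.coe_spectralProbabilityMeasure _ hy, measureReal_def]
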